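/- Let $f:[0,\infty)\to\mathbb{R}$ be operator monotone, i.e. for positive semidefinite complex matrices $A\le B$ of any size, $f(A)\le f(B)$. Let $\rho,\sigma$ be density matrices on $\mathbb{C}^d$ (positive semidefinite, trace one) with $\rho>0$ (positive definite). A reverse test of $\{\rho,\sigma\}$ is a triple $(\Phi,\{p,q\})$ consisting of probability distributions $p,q$ on a finite set $\mathcal{X}$ and a completely positive trace preserving map $\Phi$ from functions on $\mathcal{X}$ to $d\times d$ matrices with $\Phi(p)=\rho$ and $\Phi(q)=\sigma$. It is called minimal if $|\mathcal{X}|=d$ and $\Phi(\delta_x)$ is a pure state for every $x\in\mathcal{X}$, where $\delta_x$ is the point mass at $x$. Put $$F_f(p,q)=\sum_{x\in\mathcal{X}}p(x)\,f\!\left(\frac{q(x)}{p(x)}\right),$$ where a summand with $p(x)=0$ is read as $q(x)\lim_{t\to\infty}f(t)/t$. Then the maximum of $F_f(p,q)$ over all reverse tests of $\{\rho,\sigma\}$ (over all finite sets $\mathcal{X}$) exists and $$\max F_f(p,q)=\operatorname{tr}\,\rho^{1/2}f\!\left(\rho^{-1/2}\sigma\rho^{-1/2}\right)\rho^{1/2}.$$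 Moreover, minimal reverse tests exist, and every minimal reverse test attains the maximum. If in addition $f$ is continuous and nonnegative on $[0,\infty)$, then there is a Kubo–Ando operator connection $\natural$ with representing function $f$, and every such connection satisfies $\rho\,\natural\,\sigma=\rho^{1/2}f(\rho^{-1/2}\sigma\rho^{-1/2})\rho^{1/2}$; hence the maximum equals $\operatorname{tr}(\rho\,\natural\,\sigma)$. Here an operator connection is a binary operation on positive semidefinite matrices of each size, with positive semidefinite values, that is monotone in both arguments, satisfies $S(A\natural B)S^\dagger\le(SAS^\dagger)\natural(SBS^\dagger)$ for all rectangular matrices $S$, and satisfies $A_j\natural B_j\to A\natural B$ whenever $A_j\downarrow A$ and $B_j\downarrow B$; its representing function is $f$ if $1\natural(t1)=f(t)1$ for all $t\ge 0$ (in every size). -/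

import Mathlib

open scoped MatrixOrder ComplexOrder

noncomputable section

/-- `f` is operator monotone on `[0, ∞)`: for positive semidefinite complex matrices of every size,
`A ≤ B` (Loewner order) implies `f(A) ≤ f(B)` (functional calculus). Only the values of `f` on
`[0, ∞)` matter. -/
def OperatorMonotone (f : ℝ → ℝ) : Prop :=
  ∀ (n : ℕ) (A B : Matrix (Fin n) (Fin n) ℂ),
    A.PosSemidef → B.PosSemidef → A ≤ B → cfc f A ≤ cfc f B

/-- The summand `p f(q/p)`, with the usual convention `0 · f(q/0) = q · lim_{t → ∞} f(t)/t`
(which is the limit of `s f(q/s)` as `s ↓ 0`, and is `0` for `q = 0`). -/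
def perspective (f : ℝ → ℝ) (p q : ℝ) : ℝ :=
  if p = 0 then q * Filter.limUnder Filter.atTop (fun t : ℝ => f t / t) else p * f (q / p)

/-- The classical generalized fidelity `F_f(p, q) = ∑ₓ p(x) f(q(x) / p(x))`. -/
def classicalF {X : Type*} [Fintype X] (f : ℝ → ℝ) (p q : X → ℝ) : ℝ :=
  ∑ x, perspective f (p x) (q x)

/-- `ω = |φ⟩⟨φ|` for a unit vector `φ`. -/
def IsPureState {d : ℕ} (ω : Matrix (Fin d) (Fin d) ℂ) : Prop :=
  ∃ φ : Fin d → ℂ, star φ ⬝ᵥ φ = 1 ∧ ω = Matrix.vecMulVec φ (star φ)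

section

open scoped Matrix.Norms.L2Operator CStarAlgebra

/-- A reverse test `(Φ, {p, q})` of `{ρ, σ}` over the finite set `X`: a completely positive trace
preserving map `Φ` from the commutative algebra of functions on `X` to the `d × d` matrices, with
probability distributions `p`, `q` on `X` such that `Φ(p) = ρ` and `Φ(q) = σ`. -/
structure ReverseTest (X : Type*) [Fintype X] {d : ℕ} (ρ σ : Matrix (Fin d) (Fin d) ℂ) where
  Φ : (X → ℂ) →CP Matrix (Fin d) (Fin d) ℂ
  p : X → ℝ
  q : X → ℝ
  trace_preserving : ∀ a : X → ℂ, (Φ a).trace = ∑ x, a x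
  p_mem : p ∈ stdSimplex ℝ X
  q_mem : q ∈ stdSimplex ℝ X
  map_p : Φ (fun x => (p x : ℂ)) = ρ
  map_q : Φ (fun x => (q x : ℂ)) = σ

open scoped Classical in
/-- A reverse test is minimal if `|X| = d` and every `Φ(δₓ)` is a pure state. -/
def ReverseTest.IsMinimal {X : Type*} [Fintype X] {d : ℕ} {ρ σ : Matrix (Fin d) (Fin d) ℂ}
    (R : ReverseTest X ρ σ) : Prop :=
  Fintype.card X = d ∧ ∀ x : X, IsPureState (R.Φ (Pi.single x 1))

end

/-- The set of all values `F_f(p, q)` over reverse tests `(Φ, {p, q})` of `{ρ, σ}`; its maximum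
is `F_f^min(ρ, σ)`. -/
def reverseTestValues (f : ℝ → ℝ) {d : ℕ} (ρ σ : Matrix (Fin d) (Fin d) ℂ) : Set ℝ :=
  {v | ∃ (X : Type) (_ : Fintype X) (R : ReverseTest X ρ σ), v = classicalF f R.p R.q}

/-- `ρ^{1/2} f(ρ^{-1/2} σ ρ^{-1/2}) ρ^{1/2}` (used for positive definite `ρ`). -/
def matrixPerspective (f : ℝ → ℝ) {d : ℕ} (ρ σ : Matrix (Fin d) (Fin d) ℂ) :
    Matrix (Fin d) (Fin d) ℂ :=
  cfc Real.sqrt ρ * cfc f ((cfc Real.sqrt ρ)⁻¹ * σ * (cfc Real.sqrt ρ)⁻¹) * cfc Real.sqrt ρ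

/-- `F'_f(ρ, σ) = tr ρ^{1/2} f(ρ^{-1/2} σ ρ^{-1/2}) ρ^{1/2}`. -/
def FPrime (f : ℝ → ℝ) {d : ℕ} (ρ σ : Matrix (Fin d) (Fin d) ℂ) : ℝ :=
  (matrixPerspective f ρ σ).trace.re

/-- Kubo–Ando operator connections on positive semidefinite matrices of all sizes: binary
operations that are monotone in both arguments, satisfy the transformer inequality
`S (A c B) S† ≤ (S A S†) c (S B S†)`, and are continuous along decreasing sequences. Values at
arguments that are not positive semidefinite are irrelevant. -/
structure IsOperatorConnection
    (c : ∀ n : ℕ, Matrix (Fin n) (Fin n) ℂ → Matrix (Fin n) (Fin n) ℂ →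
      Matrix (Fin n) (Fin n) ℂ) : Prop where
  posSemidef : ∀ (n : ℕ) (A B : Matrix (Fin n) (Fin n) ℂ),
    A.PosSemidef → B.PosSemidef → (c n A B).PosSemidef
  monotone : ∀ (n : ℕ) (A B C D : Matrix (Fin n) (Fin n) ℂ),
    A.PosSemidef → B.PosSemidef → A ≤ C → B ≤ D → c n A B ≤ c n C D
  transformer : ∀ (m n : ℕ) (S : Matrix (Fin m) (Fin n) ℂ) (A B : Matrix (Fin n) (Fin n) ℂ),
    A.PosSemidef → B.PosSemidef →
      S * c n A B * S.conjTranspose ≤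
        c m (S * A * S.conjTranspose) (S * B * S.conjTranspose)
  continuous_above : ∀ (n : ℕ) (A B : ℕ → Matrix (Fin n) (Fin n) ℂ)
    (A₀ B₀ : Matrix (Fin n) (Fin n) ℂ),
    (∀ j, (A j).PosSemidef) → (∀ j, (B j).PosSemidef) → Antitone A → Antitone B →
    Filter.Tendsto A Filter.atTop (nhds A₀) → Filter.Tendsto B Filter.atTop (nhds B₀) →
      Filter.Tendsto (fun j => c n (A j) (B j)) Filter.atTop (nhds (c n A₀ B₀))

/-- `c` is the connection of `f`: it is an operator connection with representing function `f`,
that is, `1 c (t 1) = f(t) 1` for `t ≥ 0`. -/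
def IsConnectionOf (f : ℝ → ℝ)
    (c : ∀ n : ℕ, Matrix (Fin n) (Fin n) ℂ → Matrix (Fin n) (Fin n) ℂ →
      Matrix (Fin n) (Fin n) ℂ) : Prop :=
  IsOperatorConnection c ∧
    ∀ (n : ℕ) (t : ℝ), 0 ≤ t → c n 1 ((t : ℂ) • 1) = (f t : ℂ) • 1

end

/-! Put h = ρ^{1/2}. A reverse test amounts to states Ω_x = Φ(δ_x) with ∑ p(x) Ω_x = ρ and ∑ q(x)
Ω_x = σ. Conjugating by h⁻¹ turns the first identity into a resolution of the identity with weights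
p(x) h⁻¹Ω_x h⁻¹, and the second says that the mean of the points q(x)/p(x) under these weights is
h⁻¹σh⁻¹. Jensen's operator inequality `OperatorMonotone.sum_smul_le_cfc`, conjugated by h and
traced, is then the upper bound (`sum_perspective_le_FPrime`). Outcomes with p(x) = 0 enter through
a limit in which they get small weight at a point tending to infinity.

Jensen's inequality itself comes from operator monotonicity by dilating the weights to an isometry
and dominating the dilated matrix by a block diagonal one; the resulting loss is a factor 1 + ε in
the argument, which continuity on (0, ∞) removes.

For a minimal test the vectors √p(x) φ_x form a square matrix N with ρ = N Nᴴ and σ = N diag(q/p)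
Nᴴ, so h⁻¹N is unitary and diagonalizes h⁻¹σh⁻¹: both sides become ∑ p f(q/p). Conversely,
diagonalizing h⁻¹σh⁻¹ produces such an N (`exists_isMinimal`).

The axioms of a connection fix it on pairs (1, D) with D diagonal, and covariance under invertible
matrices does the rest. Existence is proved by perturbing the first argument to A + ε and letting ε
decrease to 0; Hansen's inequality `OperatorMonotone.contraction_le` supplies both monotonicity in
the first argument and the transformer inequality. -/

open Filter Topology

/-! ### Functional calculus of Hermitian matrices -/

namespace Matrix

variable {m n : Type*} [Fintype m] [DecidableEq m] [Fintype n] [DecidableEq n]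

/-- The functional calculus respects intertwining relations between Hermitian matrices. -/
lemma IsHermitian.cfc_mul_eq_mul_cfc {A : Matrix m m ℂ} {B : Matrix n n ℂ} (hA : A.IsHermitian)
    (hB : B.IsHermitian) {X : Matrix m n ℂ} (h : A * X = X * B) (f : ℝ → ℝ) :
    cfc f A * X = X * cfc f B := by
  classical
  -- Both spectra are finite, so a single polynomial agrees with `f` on their union; polynomials
  -- respect intertwiners.
  have hfin : (spectrum ℝ A ∪ spectrum ℝ B).Finite :=
    finite_real_spectrum.union finite_real_spectrum
  set p : Polynomial ℝ := Lagrange.interpolate hfin.toFinset id f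
  have hp : ∀ x ∈ spectrum ℝ A ∪ spectrum ℝ B, f x = p.eval x := fun x hx =>
    (Lagrange.eval_interpolate_at_node (v := id) f Function.injective_id.injOn
      (hfin.mem_toFinset.2 hx)).symm
  rw [cfc_congr (g := fun x => p.eval x) fun x hx => hp x (Or.inl hx),
    cfc_congr (a := B) (g := fun x => p.eval x) fun x hx => hp x (Or.inr hx),
    cfc_polynomial p A hA.isSelfAdjoint, cfc_polynomial p B hB.isSelfAdjoint]
  induction p using Polynomial.induction_on' with
  | add p q hp hq => simp [Matrix.add_mul, Matrix.mul_add, hp, hq]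
  | monomial k a =>
    have hpow : A ^ k * X = X * B ^ k := by
      induction k with
      | zero => simp
      | succ k ih => rw [pow_succ, Matrix.mul_assoc, h, ← Matrix.mul_assoc, ih, Matrix.mul_assoc,
          ← pow_succ]
    simp only [Polynomial.aeval_monomial, Algebra.algebraMap_eq_smul_one, smul_mul_assoc, one_mul,
      Matrix.smul_mul, Matrix.mul_smul, hpow]

lemma isHermitian_diagonal_ofReal {n : Type*} [DecidableEq n] (t : n → ℝ) :
    (diagonal fun i => (t i : ℂ)).IsHermitian :=
  isHermitian_diagonal_of_self_adjoint _ (by ext i; simp)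

/-- The j-th basis column intertwines the diagonal matrix with the 1 × 1 matrix `t j`, which yields
the j-th column of the result. -/
lemma cfc_diagonal_ofReal (t : n → ℝ) (f : ℝ → ℝ) :
    cfc f (diagonal fun i => (t i : ℂ)) = diagonal fun i => (f (t i) : ℂ) := by
  ext i j
  have h := (isHermitian_diagonal_ofReal t).cfc_mul_eq_mul_cfc
    (X := of fun i (_ : Unit) => if i = j then (1 : ℂ) else 0)
    (isHermitian_diagonal_ofReal fun _ : Unit => t j)
    (by ext i _; by_cases hij : i = j <;> simp [diagonal_mul, mul_diagonal, hij]) f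
  have h1 : (diagonal fun _ : Unit => (t j : ℂ)) = algebraMap ℝ (Matrix Unit Unit ℂ) (t j) := by
    ext; simp [algebraMap_matrix_apply]
  rw [h1, cfc_algebraMap] at h
  have := congr_fun (congr_fun h i) ()
  simp [mul_apply, algebraMap_matrix_apply] at this
  rw [this, diagonal_apply]
  by_cases hij : i = j <;> simp [hij]

lemma IsHermitian.exists_eq_unitary_mul_diagonal {A : Matrix n n ℂ} (hA : A.IsHermitian) :
    ∃ (U : Matrix n n ℂ) (t : n → ℝ), Uᴴ * U = 1 ∧ U * Uᴴ = 1 ∧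
      A = U * (diagonal fun i => (t i : ℂ)) * Uᴴ := by
  refine ⟨hA.eigenvectorUnitary, hA.eigenvalues, ?_, ?_, ?_⟩
  · exact Unitary.coe_star_mul_self hA.eigenvectorUnitary
  · exact Unitary.coe_mul_star_self hA.eigenvectorUnitary
  · exact hA.spectral_theorem

lemma cfc_unitary_mul_diagonal {U : Matrix m n ℂ} (h1 : Uᴴ * U = 1) (h2 : U * Uᴴ = 1)
    (t : n → ℝ) (f : ℝ → ℝ) :
    cfc f (U * (diagonal fun i => (t i : ℂ)) * Uᴴ) =
      U * (diagonal fun i => (f (t i) : ℂ)) * Uᴴ := by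
  have hD := isHermitian_diagonal_ofReal t
  have hA : (U * (diagonal fun i => (t i : ℂ)) * Uᴴ).IsHermitian :=
    isHermitian_mul_mul_conjTranspose _ hD
  have h := hA.cfc_mul_eq_mul_cfc (X := U) hD
    (by rw [Matrix.mul_assoc, h1, Matrix.mul_one]) f
  rw [cfc_diagonal_ofReal] at h
  rw [← h, Matrix.mul_assoc _ U, h2, Matrix.mul_one]

lemma mul_mul_conjTranspose_mono {m n : Type*} [Fintype m] [Fintype n] {A B : Matrix n n ℂ}
    (h : A ≤ B) (S : Matrix m n ℂ) :
    S * A * Sᴴ ≤ S * B * Sᴴ := by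
  rw [le_iff] at h ⊢
  simpa [Matrix.mul_sub, Matrix.sub_mul] using h.mul_mul_conjTranspose_same S

lemma conjTranspose_mul_mul_mono {m n : Type*} [Fintype m] [Fintype n] {A B : Matrix n n ℂ}
    (h : A ≤ B) (S : Matrix n m ℂ) :
    Sᴴ * A * S ≤ Sᴴ * B * S := by
  simpa using mul_mul_conjTranspose_mono h Sᴴ

lemma PosSemidef.diagonal_nonneg_of_unitary {U : Matrix n n ℂ} (h1 : Uᴴ * U = 1) {t : n → ℝ}
    (h : (U * (diagonal fun i => (t i : ℂ)) * Uᴴ).PosSemidef) (i : n) : 0 ≤ t i := by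
  have := h.conjTranspose_mul_mul_same U
  rw [show Uᴴ * (U * (diagonal fun i => (t i : ℂ)) * Uᴴ) * U
    = (Uᴴ * U) * (diagonal fun i => (t i : ℂ)) * (Uᴴ * U) by simp only [Matrix.mul_assoc],
    h1, Matrix.one_mul, Matrix.mul_one] at this
  simpa using this.diag_nonneg (i := i)

end Matrix

open Matrix

/-! ### Jensen's operator inequality -/

/-- Jensen's inequality for compressions by isometries, up to a dilation of the argument. -/
lemma OperatorMonotone.compress_le {f : ℝ → ℝ} (hf : OperatorMonotone f) {N n : ℕ}
    {A : Matrix (Fin N) (Fin N) ℂ} (hA : A.PosSemidef) {V : Matrix (Fin N) (Fin n) ℂ}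
    (hV : Vᴴ * V = 1) {ε : ℝ} (hε : 0 < ε) :
    Vᴴ * cfc f A * V ≤ cfc f ((1 + ε) • (Vᴴ * A * V)) := by
  set P := V * Vᴴ with hP
  set Q := 1 - P with hQ
  have hPh : Pᴴ = P := by simp [hP]
  have hQh : Qᴴ = Q := by simp [hQ, hPh]
  have hPV : P * V = V := by rw [hP, Matrix.mul_assoc, hV, Matrix.mul_one]
  have hQV : Q * V = 0 := by rw [hQ, Matrix.sub_mul, hPV, Matrix.one_mul, sub_self]
  have hPAP : (P * A * P).PosSemidef := by
    simpa [hPh] using hA.conjTranspose_mul_mul_same P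
  have hQAQ : (Q * A * Q).PosSemidef := by
    simpa [hQh] using hA.conjTranspose_mul_mul_same Q
  -- Block diagonal majorant of A for the projections P, Q: the difference B - A is ε⁻¹ (εP - Q) A
  -- (εP - Q), and V intertwines B with the dilated compression.
  set B := (1 + ε) • (P * A * P) + (1 + ε⁻¹) • (Q * A * Q) with hB
  have hBpos : B.PosSemidef :=
    (hPAP.smul (by positivity : (0 : ℝ) ≤ 1 + ε)).add
      (hQAQ.smul (by positivity : (0 : ℝ) ≤ 1 + ε⁻¹))
  have hAB : A ≤ B := by
    have h := (hA.conjTranspose_mul_mul_same (ε • P - Q)).smul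
      (by positivity : (0 : ℝ) ≤ ε⁻¹)
    suffices heq : B - A = ε⁻¹ • ((ε • P - Q)ᴴ * A * (ε • P - Q)) by
      rw [le_iff, heq]
      exact h
    have hPQ : A = (P + Q) * A * (P + Q) := by simp [hQ]
    rw [show B - A = B - (P + Q) * A * (P + Q) by rw [← hPQ], hB,
      conjTranspose_sub, conjTranspose_smul, hPh, hQh]
    simp only [Matrix.add_mul, Matrix.mul_add, Matrix.sub_mul, Matrix.mul_sub, Matrix.smul_mul,
      Matrix.mul_smul, smul_sub, smul_smul, star_trivial]
    rw [inv_mul_cancel₀ hε.ne', inv_mul_cancel_left₀ hε.ne']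
    module
  have hBV : B * V = V * ((1 + ε) • (Vᴴ * A * V)) := by
    simp only [hB, Matrix.add_mul, Matrix.smul_mul, Matrix.mul_assoc, hPV, hQV, Matrix.mul_zero,
      smul_zero, add_zero, Matrix.mul_smul]
    rw [hP, Matrix.mul_assoc]
  have hT : ((1 + ε) • (Vᴴ * A * V)).PosSemidef :=
    (hA.conjTranspose_mul_mul_same V).smul (by positivity)
  calc Vᴴ * cfc f A * V ≤ Vᴴ * cfc f B * V :=
        conjTranspose_mul_mul_mono (hf N A B hA hBpos hAB) V
    _ = cfc f ((1 + ε) • (Vᴴ * A * V)) := by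
      rw [Matrix.mul_assoc, hBpos.1.cfc_mul_eq_mul_cfc hT.1 hBV, ← Matrix.mul_assoc, hV,
        Matrix.one_mul]

/-- Jensen's inequality for resolutions of the identity, up to a dilation of the argument. -/
lemma OperatorMonotone.sum_smul_le_cfc_dilate {f : ℝ → ℝ} (hf : OperatorMonotone f) {ι : Type*}
    [Fintype ι] {n : ℕ} {E : ι → Matrix (Fin n) (Fin n) ℂ} (hE : ∀ i, (E i).PosSemidef)
    (hsum : ∑ i, E i = 1) {t : ι → ℝ} (ht : ∀ i, 0 ≤ t i) {ε : ℝ} (hε : 0 < ε) :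
    ∑ i, f (t i) • E i ≤ cfc f ((1 + ε) • ∑ i, t i • E i) := by
  classical
  choose R hR using fun i => CStarAlgebra.nonneg_iff_eq_star_mul_self.mp (hE i).nonneg
  -- Naimark dilation: with E i = (R i)ᴴ R i, stacking the R i gives an isometry V, and the
  -- t-weighted sum of the E i is the compression of a diagonal matrix.
  let e := Fintype.equivFin (ι × Fin n)
  let V : Matrix (Fin (Fintype.card (ι × Fin n))) (Fin n) ℂ :=
    of fun k b => R (e.symm k).1 (e.symm k).2 b
  have key : ∀ s : ι → ℝ,
      Vᴴ * (diagonal fun k => (s (e.symm k).1 : ℂ)) * V = ∑ i, s i • E i := by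
    intro s
    ext a b
    rw [mul_apply, Matrix.sum_apply]
    simp only [mul_diagonal, conjTranspose_apply, V, of_apply]
    rw [e.symm.sum_comp (fun x : ι × Fin n => star (R x.1 x.2 a) * (s x.1 : ℂ) * R x.1 x.2 b),
      Fintype.sum_prod_type]
    refine Finset.sum_congr rfl fun i _ => ?_
    rw [hR i, Matrix.smul_apply, star_eq_conjTranspose, mul_apply, Complex.real_smul, Finset.mul_sum]
    refine Finset.sum_congr rfl fun j _ => ?_
    rw [conjTranspose_apply]; ring
  have hV : Vᴴ * V = 1 := by
    have := key fun _ => 1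
    simpa [hsum] using this
  have hA : (diagonal fun k => (t (e.symm k).1 : ℂ)).PosSemidef :=
    .diagonal fun k => by simpa using ht _
  have := hf.compress_le hA hV hε
  rwa [cfc_diagonal_ofReal (fun k => t (e.symm k).1), key t, key fun i => f (t i)] at this

lemma cfc_real_smul_one {n : Type*} [Fintype n] [DecidableEq n] (f : ℝ → ℝ) (t : ℝ) :
    cfc f (t • (1 : Matrix n n ℂ)) = f t • (1 : Matrix n n ℂ) := by
  rw [← Algebra.algebraMap_eq_smul_one, cfc_algebraMap, Algebra.algebraMap_eq_smul_one]

lemma Matrix.real_smul_one_le_iff {n : ℕ} [NeZero n] {s t : ℝ} :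
    s • (1 : Matrix (Fin n) (Fin n) ℂ) ≤ t • (1 : Matrix (Fin n) (Fin n) ℂ) ↔ s ≤ t := by
  rw [le_iff, ← sub_smul]
  refine ⟨fun h => ?_, fun h => PosSemidef.one.smul (sub_nonneg.2 h)⟩
  have := h.diag_nonneg (i := 0)
  simp only [Matrix.smul_apply, one_apply_eq, Complex.real_smul, mul_one] at this
  exact sub_nonneg.1 (by exact_mod_cast this)

namespace OperatorMonotone

variable {f : ℝ → ℝ}

lemma le_of_le (hf : OperatorMonotone f) {s t : ℝ} (hs : 0 ≤ s) (hst : s ≤ t) : f s ≤ f t := by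
  have h := hf 1 (s • 1) (t • 1) (PosSemidef.one.smul hs) (PosSemidef.one.smul (hs.trans hst))
    (real_smul_one_le_iff.2 hst)
  rwa [cfc_real_smul_one, cfc_real_smul_one, real_smul_one_le_iff] at h

/-- Concavity with a strict gap, which absorbs the factor 1 + ε; this weak form already forces
continuity on (0, ∞). -/
lemma convex_comb_le_of_lt (hf : OperatorMonotone f) {s t w u : ℝ} (hs : 0 ≤ s) (ht : 0 ≤ t)
    (hw : 0 ≤ w) (hw1 : w ≤ 1) (hu : w * s + (1 - w) * t < u) :
    w * f s + (1 - w) * f t ≤ f u := by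
  set v := w * s + (1 - w) * t with hv
  have hv0 : 0 ≤ v := add_nonneg (mul_nonneg hw hs) (mul_nonneg (sub_nonneg.2 hw1) ht)
  -- Chosen so that (1 + ε) v ≤ u; the denominator v + 1 also covers v = 0.
  have hε : 0 < (u - v) / (v + 1) := div_pos (sub_pos.2 hu) (by linarith)
  have h := hf.sum_smul_le_cfc_dilate (n := 1) (E := ![w • 1, (1 - w) • 1]) (t := ![s, t])
    (by
      intro i; fin_cases i
      · exact PosSemidef.one.smul hw
      · exact PosSemidef.one.smul (sub_nonneg.2 hw1))
    (by simp [← add_smul])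
    (by intro i; fin_cases i <;> simpa)
    hε
  simp only [Fin.sum_univ_two, Matrix.cons_val_zero, Matrix.cons_val_one, smul_smul,
    ← add_smul] at h
  rw [cfc_real_smul_one, real_smul_one_le_iff] at h
  have hle : (1 + (u - v) / (v + 1)) * (s * w + t * (1 - w)) ≤ u := by
    have : s * w + t * (1 - w) = v := by rw [hv]; ring
    rw [this, add_mul, one_mul, div_mul_eq_mul_div]
    have : (u - v) * v / (v + 1) ≤ u - v := by
      rw [div_le_iff₀ (by linarith)]
      nlinarith
    linarith
  have h0 : 0 ≤ (1 + (u - v) / (v + 1)) * (s * w + t * (1 - w)) :=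
    mul_nonneg (by linarith) (by
      have : s * w + t * (1 - w) = v := by rw [hv]; ring
      rwa [this])
  linarith [hf.le_of_le h0 hle]

/-- Operator monotone functions are continuous on the open half line. -/
lemma continuousAt (hf : OperatorMonotone f) {t : ℝ} (ht : 0 < t) : ContinuousAt f t := by
  rw [Metric.continuousAt_iff']
  intro δ hδ
  set C := f (2 * t) - f (t / 2)
  have hC : 0 ≤ C := sub_nonneg.2 (hf.le_of_le (by linarith) (by linarith))
  set w := min (1 / 2) (δ / (C + 1) / 2)
  have hw : 0 < w := lt_min (by norm_num) (by positivity)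
  have hw2 : w ≤ 1 / 2 := min_le_left _ _
  have hwC : w * C < δ := by
    have h1 : w ≤ δ / (C + 1) / 2 := min_le_right _ _
    have h2 : δ / (C + 1) / 2 * (C + 1) = δ / 2 := by field_simp
    nlinarith
  -- Near t, mixing a fraction w of t/2 into either of s, t lands strictly below the other, so f(s)
  -- and f(t) differ by at most w C.
  have e1 : ∀ᶠ s in 𝓝 t, w * (t / 2) + (1 - w) * s < t :=
    (by fun_prop : Continuous fun s => w * (t / 2) + (1 - w) * s).continuousAt.eventually_lt
      continuousAt_const (by nlinarith)
  have e2 : ∀ᶠ s in 𝓝 t, w * (t / 2) + (1 - w) * t < s :=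
    eventually_gt_nhds (by nlinarith)
  filter_upwards [e1, e2, eventually_lt_nhds (show t < 2 * t by linarith),
    eventually_gt_nhds (show t / 2 < t by linarith)] with s h1 h2 h3 h4
  rw [Real.dist_eq, abs_lt]
  have i1 := hf.convex_comb_le_of_lt (by linarith) (by linarith) hw.le (by linarith) h1
  have i2 := hf.convex_comb_le_of_lt (by linarith) (by linarith) hw.le (by linarith) h2
  have j1 : f s ≤ f (2 * t) := hf.le_of_le (by linarith) h3.le
  have j2 : f t ≤ f (2 * t) := hf.le_of_le (by linarith) (by linarith)
  have k1 : w * (f s - f (t / 2)) ≤ w * C := mul_le_mul_of_nonneg_left (by linarith) hw.le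
  have k2 : w * (f t - f (t / 2)) ≤ w * C := mul_le_mul_of_nonneg_left (by linarith) hw.le
  constructor <;> nlinarith

/-- Dilations fix 0, so a possible jump of `f` at 0 does no harm. -/
lemma tendsto_mul (hf : OperatorMonotone f) {t : ℝ} (ht : 0 ≤ t) {α : Type*} {l : Filter α}
    {c : α → ℝ} (hc : Tendsto c l (𝓝 1)) : Tendsto (fun a => f (c a * t)) l (𝓝 (f t)) := by
  rcases ht.eq_or_lt with rfl | ht
  · simpa using tendsto_const_nhds
  · refine (hf.continuousAt ht).tendsto.comp ?_
    simpa using hc.mul_const t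

/-- **Jensen's operator inequality** for resolutions of the identity. -/
lemma sum_smul_le_cfc (hf : OperatorMonotone f) {ι : Type*}
    [Fintype ι] {n : ℕ} {E : ι → Matrix (Fin n) (Fin n) ℂ} (hE : ∀ i, (E i).PosSemidef)
    (hsum : ∑ i, E i = 1) {t : ι → ℝ} (ht : ∀ i, 0 ≤ t i) :
    ∑ i, f (t i) • E i ≤ cfc f (∑ i, t i • E i) := by
  open scoped Matrix.Norms.L2Operator in
  have hT : (∑ i, t i • E i).PosSemidef := posSemidef_sum _ fun i _ => (hE i).smul (ht i)
  obtain ⟨U, s, h1, h2, hs⟩ := hT.1.exists_eq_unitary_mul_diagonal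
  have hs0 : ∀ i, 0 ≤ s i := PosSemidef.diagonal_nonneg_of_unitary h1 (hs ▸ hT)
  have hlim : Tendsto (fun ε : ℝ => cfc f ((1 + ε) • ∑ i, t i • E i)) (𝓝[>] 0)
      (𝓝 (cfc f (∑ i, t i • E i))) := by
    have : ∀ ε : ℝ, (1 + ε) • ∑ i, t i • E i =
        U * (diagonal fun i => (((1 + ε) * s i : ℝ) : ℂ)) * Uᴴ := by
      intro ε
      rw [hs, ← Matrix.smul_mul, ← Matrix.mul_smul, ← diagonal_smul]
      congr 3
      ext i
      simp
    simp_rw [this]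
    simp_rw [cfc_unitary_mul_diagonal h1 h2 fun i => (1 + _) * s i]
    rw [hs, cfc_unitary_mul_diagonal h1 h2]
    refine ((tendsto_const_nhds.mul ?_).mul tendsto_const_nhds)
    refine (Continuous.matrix_diagonal continuous_id).continuousAt.tendsto.comp ?_
    refine tendsto_pi_nhds.2 fun i => ?_
    refine (Complex.continuous_ofReal.tendsto _).comp (hf.tendsto_mul (hs0 i) ?_)
    exact tendsto_nhdsWithin_of_tendsto_nhds
      (Continuous.tendsto' (by fun_prop) _ _ (by simp))
  refine ge_of_tendsto hlim ?_
  filter_upwards [self_mem_nhdsWithin] with ε hε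
  exact hf.sum_smul_le_cfc_dilate hE hsum ht hε

/-- Scalar Jensen at the points t and 0 with weights s/t and 1 - s/t: the chord slopes from 0
decrease. -/
lemma sub_div_antitone (hf : OperatorMonotone f) {s t : ℝ} (hs : 0 < s) (hst : s ≤ t) :
    (f t - f 0) / t ≤ (f s - f 0) / s := by
  have ht := hs.trans_le hst
  have hw : s / t ≤ 1 := (div_le_one ht).2 hst
  have hw0 : 0 ≤ s / t := by positivity
  have h := hf.sum_smul_le_cfc (n := 1) (E := ![(s / t) • 1, (1 - s / t) • 1]) (t := ![t, 0])
    (by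
      intro i; fin_cases i
      · exact PosSemidef.one.smul hw0
      · exact PosSemidef.one.smul (sub_nonneg.2 hw))
    (by simp [← add_smul])
    (by intro i; fin_cases i <;> simp [ht.le])
  simp only [Fin.sum_univ_two, Matrix.cons_val_zero, Matrix.cons_val_one, smul_smul,
    ← add_smul] at h
  rw [cfc_real_smul_one, real_smul_one_le_iff] at h
  rw [zero_mul, add_zero, mul_div_cancel₀ _ ht.ne'] at h
  rw [div_le_div_iff₀ ht hs]
  have h2 : (f t * (s / t) + f 0 * (1 - s / t)) * t = f t * s + f 0 * (t - s) := by
    field_simp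
  nlinarith [mul_le_mul_of_nonneg_right h ht.le]

/-- The limit `lim f(t)/t` that enters `perspective` exists. -/
lemma tendsto_div_atTop (hf : OperatorMonotone f) :
    Tendsto (fun t : ℝ => f t / t) atTop (𝓝 (limUnder atTop fun t : ℝ => f t / t)) := by
  refine tendsto_nhds_limUnder ?_
  -- Truncating at 1 makes the slope antitone on all of ℝ without changing its behaviour at
  -- infinity.
  have hanti : Antitone fun t : ℝ => (f (max t 1) - f 0) / max t 1 := fun s t hst =>
    hf.sub_div_antitone (by positivity) (max_le_max_right 1 hst)
  have hbdd : BddBelow (Set.range fun t : ℝ => (f (max t 1) - f 0) / max t 1) := by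
    refine ⟨0, ?_⟩
    rintro _ ⟨t, rfl⟩
    exact div_nonneg (sub_nonneg.2 (hf.le_of_le le_rfl (by positivity))) (by positivity)
  have h1 := tendsto_atTop_ciInf hanti hbdd
  have h2 : Tendsto (fun t : ℝ => f 0 / t) atTop (𝓝 0) := tendsto_const_nhds.div_atTop tendsto_id
  refine ⟨_, (h1.add h2).congr' ?_⟩
  filter_upwards [eventually_ge_atTop 1] with t ht
  rw [max_eq_left ht, ← add_div, sub_add_cancel]

end OperatorMonotone

/-! ### The square root of a positive definite matrix -/

namespace Matrix

variable {n : Type*} [Fintype n] [DecidableEq n] {ρ : Matrix n n ℂ}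

lemma conjTranspose_cfc_sqrt : (cfc Real.sqrt ρ)ᴴ = cfc Real.sqrt ρ :=
  cfc_predicate (R := ℝ) (p := IsSelfAdjoint) Real.sqrt ρ

lemma PosSemidef.cfc_sqrt_mul_self (hρ : ρ.PosSemidef) :
    cfc Real.sqrt ρ * cfc Real.sqrt ρ = ρ := by
  obtain ⟨U, t, h1, h2, rfl⟩ := hρ.1.exists_eq_unitary_mul_diagonal
  have ht := PosSemidef.diagonal_nonneg_of_unitary h1 hρ
  rw [cfc_unitary_mul_diagonal h1 h2]
  rw [show ∀ D : Matrix n n ℂ, U * D * Uᴴ * (U * D * Uᴴ) = U * (D * (Uᴴ * U) * D) * Uᴴ by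
    intro D; simp only [Matrix.mul_assoc], h1, Matrix.mul_one, diagonal_mul_diagonal]
  congr 3
  ext i
  rw [← Complex.ofReal_mul, Real.mul_self_sqrt (ht i)]

lemma PosDef.isUnit_cfc_sqrt (hρ : ρ.PosDef) : IsUnit (cfc Real.sqrt ρ).det := by
  have h := (isUnit_iff_isUnit_det _).1 hρ.isUnit
  rw [← hρ.posSemidef.cfc_sqrt_mul_self, det_mul] at h
  exact isUnit_of_mul_isUnit_left h

lemma conjTranspose_inv_cfc_sqrt : ((cfc Real.sqrt ρ)⁻¹)ᴴ = (cfc Real.sqrt ρ)⁻¹ := by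
  rw [conjTranspose_nonsing_inv, conjTranspose_cfc_sqrt]

lemma PosDef.inv_sqrt_mul_mul_inv_sqrt (hρ : ρ.PosDef) :
    (cfc Real.sqrt ρ)⁻¹ * ρ * (cfc Real.sqrt ρ)⁻¹ = 1 := by
  conv_lhs => enter [1, 2]; rw [← hρ.posSemidef.cfc_sqrt_mul_self]
  rw [nonsing_inv_mul_cancel_left _ _ hρ.isUnit_cfc_sqrt, mul_nonsing_inv _ hρ.isUnit_cfc_sqrt]

lemma PosSemidef.inv_sqrt_conj {σ : Matrix n n ℂ} (hσ : σ.PosSemidef) (ρ : Matrix n n ℂ) :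
    ((cfc Real.sqrt ρ)⁻¹ * σ * (cfc Real.sqrt ρ)⁻¹).PosSemidef := by
  have := hσ.mul_mul_conjTranspose_same (cfc Real.sqrt ρ)⁻¹
  rwa [conjTranspose_inv_cfc_sqrt] at this

lemma PosDef.sqrt_mul_inv_sqrt_conj_mul (hρ : ρ.PosDef) (X : Matrix n n ℂ) :
    cfc Real.sqrt ρ * ((cfc Real.sqrt ρ)⁻¹ * X * (cfc Real.sqrt ρ)⁻¹) * cfc Real.sqrt ρ = X := by
  rw [Matrix.mul_assoc (cfc Real.sqrt ρ)⁻¹, mul_nonsing_inv_cancel_left _ _ hρ.isUnit_cfc_sqrt,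
    nonsing_inv_mul_cancel_right _ _ hρ.isUnit_cfc_sqrt]

end Matrix

/-- If `ρ = N Nᴴ` and `σ = N D Nᴴ` with `N` square and `D` real diagonal, then the matrix
perspective is `N f(D) Nᴴ`. -/
lemma matrixPerspective_eq_of_diagonal {d : ℕ} {X : Type*} [Fintype X] [DecidableEq X]
    (hX : Fintype.card X = d) {ρ : Matrix (Fin d) (Fin d) ℂ} (hρ : ρ.PosDef)
    {N : Matrix (Fin d) X ℂ} (hN : ρ = N * Nᴴ) (t : X → ℝ) (f : ℝ → ℝ) :
    matrixPerspective f ρ (N * (diagonal fun x => (t x : ℂ)) * Nᴴ) =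
      N * (diagonal fun x => (f (t x) : ℂ)) * Nᴴ := by
  set h := cfc Real.sqrt ρ with hh
  set U := h⁻¹ * N with hU
  have hUh : Uᴴ = Nᴴ * h⁻¹ := by rw [hU, conjTranspose_mul, hh, conjTranspose_inv_cfc_sqrt]
  have h2 : U * Uᴴ = 1 := by
    rw [hUh, hU, ← hρ.inv_sqrt_mul_mul_inv_sqrt, ← hh]
    conv_rhs => rw [hN]
    simp only [Matrix.mul_assoc]
  -- Squareness enters here: the co-isometry U is unitary because |X| = d.
  have h1 : Uᴴ * U = 1 := (mul_eq_one_comm_of_card_eq _ _ _ (by simp [hX])).1 h2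
  have hhU : h * U = N := by rw [hU, mul_nonsing_inv_cancel_left _ _ hρ.isUnit_cfc_sqrt]
  have hUhh : Uᴴ * h = Nᴴ := by
    rw [hUh, nonsing_inv_mul_cancel_right _ _ hρ.isUnit_cfc_sqrt]
  rw [matrixPerspective, ← hh,
    show h⁻¹ * (N * (diagonal fun x => (t x : ℂ)) * Nᴴ) * h⁻¹ =
      U * (diagonal fun x => (t x : ℂ)) * Uᴴ by rw [hUh, hU]; simp only [Matrix.mul_assoc],
    cfc_unitary_mul_diagonal h1 h2, ← Matrix.mul_assoc, ← Matrix.mul_assoc, hhU,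
    Matrix.mul_assoc _ Uᴴ, hUhh]

/-! ### The bound for arbitrary reverse tests -/

/-- Jensen's inequality for the weights p(x) E(x) at the points q(x)/p(x), followed by the positive
functional Y ↦ tr hYh, which equals 1 on every E(x). Outcomes with p(x) = 0 require perturbed
weights. -/
lemma sum_perspective_le_FPrime {f : ℝ → ℝ} (hf : OperatorMonotone f) {d : ℕ} {X : Type*}
    [Fintype X] {ρ σ : Matrix (Fin d) (Fin d) ℂ} (hρ : ρ.PosDef) {p q : X → ℝ}
    (hp : ∀ x, 0 ≤ p x) (hq : ∀ x, 0 ≤ q x) {Ω : X → Matrix (Fin d) (Fin d) ℂ}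
    (hΩ : ∀ x, (Ω x).PosSemidef) (htr : ∀ x, (Ω x).trace = 1)
    (hpρ : ∑ x, p x • Ω x = ρ) (hqσ : ∑ x, q x • Ω x = σ) :
    ∑ x, perspective f (p x) (q x) ≤ FPrime f ρ σ := by
  open scoped Matrix.Norms.L2Operator in
  classical
  set h := cfc Real.sqrt ρ with hh
  have hhh : hᴴ = h := conjTranspose_cfc_sqrt
  set E : X → Matrix (Fin d) (Fin d) ℂ := fun x => h⁻¹ * Ω x * h⁻¹ with hE
  have hEpos : ∀ x, (E x).PosSemidef := fun x => (hΩ x).inv_sqrt_conj ρ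
  have hconj : ∀ c : X → ℝ, ∑ x, c x • E x = h⁻¹ * (∑ x, c x • Ω x) * h⁻¹ := by
    intro c
    simp only [hE, Matrix.mul_sum, Matrix.sum_mul, Matrix.mul_smul, Matrix.smul_mul]
  have hpE : ∑ x, p x • E x = 1 := by rw [hconj, hpρ]; exact hρ.inv_sqrt_mul_mul_inv_sqrt
  have hqE : ∑ x, q x • E x = h⁻¹ * σ * h⁻¹ := by rw [hconj, hqσ]
  let τ : Matrix (Fin d) (Fin d) ℂ →ₗ[ℝ] ℝ :=
    { toFun := fun Y => (h * Y * h).trace.re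
      map_add' := by intro Y Z; simp [Matrix.mul_add, Matrix.add_mul]
      map_smul' := by intro r Y; simp }
  have hτmono : ∀ {Y Z}, Y ≤ Z → τ Y ≤ τ Z := by
    intro Y Z hYZ
    have h1 := (le_iff.1 (mul_mul_conjTranspose_mono hYZ h)).trace_nonneg
    rw [hhh, trace_sub] at h1
    have h2 : 0 ≤ (h * Z * h).trace.re - (h * Y * h).trace.re := (Complex.le_def.1 h1).1
    exact sub_nonneg.1 h2
  have hτE : ∀ x, τ (E x) = 1 := by
    intro x
    change (h * (h⁻¹ * Ω x * h⁻¹) * h).trace.re = 1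
    rw [hρ.sqrt_mul_inv_sqrt_conj_mul, htr, Complex.one_re]
  -- F is the part of h⁻¹σh⁻¹ invisible to p; its norm w bounds the weight it can take up.
  set F := ∑ x, (if p x = 0 then q x else 0) • E x with hF
  have hFpos : F.PosSemidef := posSemidef_sum _ fun x _ => (hEpos x).smul (by
    split_ifs
    · exact hq x
    · exact le_rfl)
  set w := ‖F‖
  have hw : (w • 1 - F).PosSemidef := by
    have := (hFpos.1.isSelfAdjoint).le_algebraMap_norm_self
    rwa [Algebra.algebraMap_eq_smul_one, le_iff] at this
  have hw0 : 0 ≤ w := norm_nonneg F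
  have main : ∀ δ : ℝ, 0 < δ → δ * w < 1 →
      δ * f 0 * τ (w • 1 - F) + ∑ x, (if p x = 0 then q x * (f δ⁻¹ / δ⁻¹) else
        (1 - δ * w) * p x * f ((1 - δ * w)⁻¹ * (q x / p x))) ≤ FPrime f ρ σ := by
    intro δ hδ hδw
    have h1 : 0 < 1 - δ * w := by linarith
    -- An invisible outcome gets weight δ q(x) E(x) at the point 1/δ, the others are scaled by 1 -
    -- δw in weight and by its inverse in position, and the extra outcome `none` fills the gap δ(w -
    -- F) at the point 0. The total weight stays 1 and the mean stays h⁻¹σh⁻¹.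
    let G : Option X → Matrix (Fin d) (Fin d) ℂ := fun o => o.elim (δ • (w • 1 - F))
      fun x => (if p x = 0 then δ * q x else (1 - δ * w) * p x) • E x
    let t : Option X → ℝ := fun o => o.elim 0
      fun x => if p x = 0 then δ⁻¹ else (1 - δ * w)⁻¹ * (q x / p x)
    have hG : ∀ o, (G o).PosSemidef := by
      rintro (_ | x)
      · exact hw.smul hδ.le
      · refine (hEpos x).smul ?_
        split_ifs
        · exact mul_nonneg hδ.le (hq x)
        · exact mul_nonneg h1.le (hp x)
    have ht : ∀ o, 0 ≤ t o := by
      rintro (_ | x)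
      · exact le_rfl
      · simp only [t, Option.elim]
        split_ifs
        · positivity
        · exact mul_nonneg (by positivity) (div_nonneg (hq x) (hp x))
    have hGsum : ∑ o, G o = 1 := by
      rw [Fintype.sum_option]
      simp only [G, Option.elim]
      have : ∀ x, (if p x = 0 then δ * q x else (1 - δ * w) * p x) • E x =
          δ • ((if p x = 0 then q x else 0) • E x) + (1 - δ * w) • (p x • E x) := by
        intro x
        split_ifs with hx <;> simp [hx, smul_smul]
      simp_rw [this]
      rw [Finset.sum_add_distrib, ← Finset.smul_sum, ← Finset.smul_sum, hpE, ← hF]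
      module
    have hGt : ∑ o, t o • G o = h⁻¹ * σ * h⁻¹ := by
      rw [Fintype.sum_option, ← hqE]
      simp only [G, t, Option.elim, zero_smul, zero_add]
      refine Finset.sum_congr rfl fun x _ => ?_
      rw [smul_smul]
      congr 1
      split_ifs with hx
      · field_simp
      · field_simp
    have hJ := hτmono (hf.sum_smul_le_cfc hG hGsum ht)
    rw [hGt, map_sum, Fintype.sum_option] at hJ
    have hR : τ (cfc f (h⁻¹ * σ * h⁻¹)) = FPrime f ρ σ := rfl
    rw [hR] at hJ
    refine le_trans (le_of_eq ?_) hJ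
    simp only [G, t, Option.elim, map_smul, hτE, smul_eq_mul, mul_one]
    congr 1
    · ring
    · refine Finset.sum_congr rfl fun x _ => ?_
      split_ifs with hx
      · rw [div_inv_eq_mul]; ring
      · ring
  have hlin : Tendsto (fun δ : ℝ => 1 - δ * w) (𝓝[>] 0) (𝓝 1) :=
    tendsto_nhdsWithin_of_tendsto_nhds (Continuous.tendsto' (by fun_prop) _ _ (by simp))
  have hlim : Tendsto (fun δ : ℝ => δ * f 0 * τ (w • 1 - F) +
      ∑ x, (if p x = 0 then q x * (f δ⁻¹ / δ⁻¹) else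
        (1 - δ * w) * p x * f ((1 - δ * w)⁻¹ * (q x / p x)))) (𝓝[>] 0)
      (𝓝 (0 + ∑ x, perspective f (p x) (q x))) := by
    refine Tendsto.add (tendsto_nhdsWithin_of_tendsto_nhds
      (Continuous.tendsto' (by fun_prop) _ _ (by simp))) (tendsto_finsetSum _ fun x _ => ?_)
    rw [perspective]
    split_ifs with hx
    · exact (hf.tendsto_div_atTop.comp tendsto_inv_nhdsGT_zero).const_mul _
    · have h1 := hlin.inv₀ one_ne_zero
      rw [inv_one] at h1
      simpa using (hlin.mul_const (p x)).mul (hf.tendsto_mul (div_nonneg (hq x) (hp x)) h1)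
  rw [zero_add] at hlim
  refine le_of_tendsto hlim ?_
  filter_upwards [self_mem_nhdsWithin, hlin.eventually (eventually_gt_nhds one_pos)] with δ h1 h2
  exact main δ h1 (by linarith)

section

open scoped Matrix.Norms.L2Operator CStarAlgebra

namespace ReverseTest

variable {X : Type*} [Fintype X] {d : ℕ} {ρ σ : Matrix (Fin d) (Fin d) ℂ}

lemma map_ofReal [DecidableEq X] (R : ReverseTest X ρ σ) (c : X → ℝ) :
    R.Φ (fun x => (c x : ℂ)) = ∑ x, c x • R.Φ (Pi.single x 1) := by
  have : (fun x => (c x : ℂ)) = ∑ x, (c x : ℂ) • (Pi.single x 1 : X → ℂ) := by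
    ext y
    simp [Finset.sum_apply, Pi.single_apply]
  rw [this, map_sum]
  refine Finset.sum_congr rfl fun x _ => ?_
  rw [map_smul, Complex.coe_smul]

lemma posSemidef_map_single [DecidableEq X] (R : ReverseTest X ρ σ) (x : X) :
    (R.Φ (Pi.single x 1)).PosSemidef := by
  refine nonneg_iff_posSemidef.1 (map_nonneg R.Φ ?_)
  exact Pi.single_nonneg.2 zero_le_one

lemma trace_map_single [DecidableEq X] (R : ReverseTest X ρ σ) (x : X) :
    (R.Φ (Pi.single x 1)).trace = 1 := by
  rw [R.trace_preserving]; simp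

lemma classicalF_le {f : ℝ → ℝ} (hf : OperatorMonotone f) (hρ : ρ.PosDef)
    (R : ReverseTest X ρ σ) : classicalF f R.p R.q ≤ FPrime f ρ σ := by
  classical
  refine sum_perspective_le_FPrime hf hρ R.p_mem.1 R.q_mem.1 R.posSemidef_map_single
    R.trace_map_single ?_ ?_
  · rw [← R.map_ofReal, R.map_p]
  · rw [← R.map_ofReal, R.map_q]

end ReverseTest
end

/-! ### Minimal reverse tests -/

lemma mul_diagonal_mul_conjTranspose_eq_sum {m X : Type*} [Fintype X] [DecidableEq X]
    (N : Matrix m X ℂ) (t : X → ℝ) :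
    N * (diagonal fun x => (t x : ℂ)) * Nᴴ =
      ∑ x, t x • vecMulVec (fun a => N a x) (star fun a => N a x) := by
  ext a b
  rw [mul_apply, Matrix.sum_apply]
  refine Finset.sum_congr rfl fun x _ => ?_
  simp only [mul_diagonal, conjTranspose_apply, Matrix.smul_apply, vecMulVec_apply, Pi.star_apply,
    Complex.real_smul]
  ring

section

open scoped Matrix.Norms.L2Operator CStarAlgebra

/-- The completely positive map that prepares the state `Ω x` from the point mass at `x`. -/
noncomputable def preparationMap {X : Type*} [Fintype X] {d : ℕ}
    (Ω : X → Matrix (Fin d) (Fin d) ℂ) (hΩ : ∀ x, (Ω x).PosSemidef) :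
    (X → ℂ) →CP Matrix (Fin d) (Fin d) ℂ where
  toFun a := ∑ x, a x • Ω x
  map_add' a b := by simp [add_smul, Finset.sum_add_distrib]
  map_smul' c a := by simp [mul_smul, Finset.smul_sum]
  map_cstarMatrix_nonneg' k M hM := by
    change 0 ≤ M.map (fun a : X → ℂ => ∑ x, a x • Ω x)
    choose S hS using fun x => CStarAlgebra.nonneg_iff_eq_star_mul_self.mp (hΩ x).nonneg
    rw [StarOrderedRing.nonneg_iff] at hM
    induction hM using AddSubmonoid.closure_induction with
    | zero => exact le_of_eq (by ext i j : 2; simp)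
    | add M M' _ _ h h' =>
      refine (add_nonneg h h').trans_eq ?_
      ext i j : 2
      simp [add_smul, Finset.sum_add_distrib]
    | mem M hM =>
    obtain ⟨B, rfl⟩ := hM
    -- On a generator Bᴴ B of the positive cone, writing Ω x = (S x)ᴴ S x exhibits the image as the
    -- sum over x of (C x)ᴴ C x.
    let C : X → CStarMatrix (Fin k) (Fin k) (Matrix (Fin d) (Fin d) ℂ) := fun x =>
      CStarMatrix.ofMatrix (Matrix.of fun i j => B i j x • S x)
    have hC : ∀ x i j, C x i j = B i j x • S x := fun _ _ _ => rfl
    have key : (star B * B).map (fun a : X → ℂ => ∑ x, a x • Ω x) = ∑ x, star (C x) * C x := by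
      refine CStarMatrix.ext fun i j => ?_
      have hsum : ∀ s : Finset X, (∑ x ∈ s, star (C x) * C x) i j =
          ∑ x ∈ s, (star (C x) * C x) i j := by
        intro s
        induction s using Finset.cons_induction with
        | empty => rfl
        | cons x s hx ih => rw [Finset.sum_cons, Finset.sum_cons, ← ih]; rfl
      rw [hsum, CStarMatrix.map_apply]
      refine Finset.sum_congr rfl fun x _ => ?_
      rw [CStarMatrix.mul_apply, CStarMatrix.mul_apply, Finset.sum_apply, Finset.sum_smul]
      refine Finset.sum_congr rfl fun l _ => ?_
      rw [CStarMatrix.star_apply, CStarMatrix.star_apply, hC, hC, hS x, star_smul,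
        smul_mul_smul_comm]
      rfl
    refine le_of_le_of_eq ?_ key.symm
    exact Finset.sum_nonneg fun x _ => star_mul_self_nonneg _

lemma preparationMap_apply {X : Type*} [Fintype X] {d : ℕ}
    (Ω : X → Matrix (Fin d) (Fin d) ℂ) (hΩ : ∀ x, (Ω x).PosSemidef) (a : X → ℂ) :
    preparationMap Ω hΩ a = ∑ x, a x • Ω x := rfl

namespace ReverseTest

variable {X : Type*} [Fintype X] {d : ℕ} {ρ σ : Matrix (Fin d) (Fin d) ℂ}

/-- Every minimal reverse test attains `FPrime`. -/
lemma IsMinimal.classicalF_eq {R : ReverseTest X ρ σ} (hR : R.IsMinimal) (f : ℝ → ℝ)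
    (hρ : ρ.PosDef) : classicalF f R.p R.q = FPrime f ρ σ := by
  classical
  obtain ⟨hX, hpure⟩ := hR
  choose φ hφ hΦ using hpure
  have hp := R.p_mem.1
  let N : Matrix (Fin d) X ℂ := of fun a x => (√(R.p x) : ℂ) * φ x a
  have hcol : ∀ x, vecMulVec (fun a => N a x) (star fun a => N a x) =
      R.p x • vecMulVec (φ x) (star (φ x)) := by
    intro x
    ext a b
    have : (√(R.p x) : ℂ) * √(R.p x) = R.p x := by
      rw [← Complex.ofReal_mul, Real.mul_self_sqrt (hp x)]
    simp only [N, vecMulVec_apply, of_apply, Pi.star_apply, star_mul', Matrix.smul_apply,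
      Complex.real_smul, ← this]
    simp only [RCLike.star_def, Complex.conj_ofReal]
    ring
  have hΦ' : ∀ x, R.Φ (Pi.single x 1) = vecMulVec (φ x) (star (φ x)) := fun x => by
    rw [← hΦ x]
  have hNρ : ρ = N * Nᴴ := by
    have := mul_diagonal_mul_conjTranspose_eq_sum N fun _ => 1
    simp only [Complex.ofReal_one, diagonal_one, Matrix.mul_one, one_smul, hcol] at this
    rw [this]
    refine R.map_p.symm.trans ?_
    rw [R.map_ofReal]
    simp only [hΦ']
  -- A zero of p would be a zero column of N, impossible since h⁻¹N is unitary; the convention at p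
  -- = 0 never matters here.
  have hp0 : ∀ x, R.p x ≠ 0 := by
    intro x hx
    have h2 : (cfc Real.sqrt ρ)⁻¹ * N * ((cfc Real.sqrt ρ)⁻¹ * N)ᴴ = 1 := by
      rw [conjTranspose_mul, conjTranspose_inv_cfc_sqrt, ← hρ.inv_sqrt_mul_mul_inv_sqrt]
      conv_rhs => enter [1, 2]; rw [hNρ]
      simp only [Matrix.mul_assoc]
    have h1 := (mul_eq_one_comm_of_card_eq _ _ _ (by simp [hX])).1 h2
    have h3 : ((cfc Real.sqrt ρ)⁻¹ * N) *ᵥ Pi.single x 1 = 0 := by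
      rw [← mulVec_mulVec]
      have : N *ᵥ Pi.single x 1 = 0 := by
        ext a
        simp [N, hx]
      rw [this, mulVec_zero]
    have h4 := congr_arg (· *ᵥ (Pi.single x 1 : X → ℂ)) h1
    simp only [← mulVec_mulVec _ _ ((cfc Real.sqrt ρ)⁻¹ * N), h3, mulVec_zero, one_mulVec] at h4
    simpa using congr_fun h4 x
  have hNσ : σ = N * (diagonal fun x => ((R.q x / R.p x : ℝ) : ℂ)) * Nᴴ := by
    rw [mul_diagonal_mul_conjTranspose_eq_sum]
    refine R.map_q.symm.trans ?_
    rw [R.map_ofReal]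
    refine Finset.sum_congr rfl fun x _ => ?_
    rw [hcol, smul_smul, div_mul_cancel₀ _ (hp0 x), hΦ']
  have hP : matrixPerspective f ρ σ =
      N * (diagonal fun x => (f (R.q x / R.p x) : ℂ)) * Nᴴ := by
    conv_lhs => rw [hNσ]
    exact matrixPerspective_eq_of_diagonal hX hρ hNρ _ f
  rw [FPrime, hP, mul_diagonal_mul_conjTranspose_eq_sum, classicalF, trace_sum, Complex.re_sum]
  refine Finset.sum_congr rfl fun x _ => ?_
  rw [perspective, if_neg (hp0 x), hcol, ← hΦ', trace_smul, trace_smul, R.trace_map_single]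
  simp [mul_comm]

end ReverseTest

/-- Minimal reverse tests exist. -/
lemma exists_isMinimal {d : ℕ} {ρ σ : Matrix (Fin d) (Fin d) ℂ} (hρ : ρ.PosDef)
    (hρ_trace : ρ.trace = 1) (hσ : σ.PosSemidef) (hσ_trace : σ.trace = 1) :
    ∃ R : ReverseTest (Fin d) ρ σ, R.IsMinimal := by
  classical
  set h := cfc Real.sqrt ρ with hh
  have hhh : hᴴ = h := conjTranspose_cfc_sqrt
  have hM := hσ.inv_sqrt_conj ρ
  rw [← hh] at hM
  obtain ⟨U, t, h1, h2, hU⟩ := hM.1.exists_eq_unitary_mul_diagonal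
  have ht : ∀ i, 0 ≤ t i := PosSemidef.diagonal_nonneg_of_unitary h1 (hU ▸ hM)
  -- The columns of N are the unnormalized pure states; p(x) is the squared norm of column x and
  -- q(x) = t(x) p(x).
  set N := h * U with hN
  have hNρ : N * Nᴴ = ρ := by
    rw [hN, conjTranspose_mul, hhh, Matrix.mul_assoc, ← Matrix.mul_assoc U, h2, Matrix.one_mul]
    exact hρ.posSemidef.cfc_sqrt_mul_self
  have hNσ : N * (diagonal fun x => (t x : ℂ)) * Nᴴ = σ := by
    rw [← hρ.sqrt_mul_inv_sqrt_conj_mul σ, ← hh, hU, hN, conjTranspose_mul, hhh]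
    simp only [Matrix.mul_assoc]
  let v : Fin d → Fin d → ℂ := fun x a => N a x
  let p : Fin d → ℝ := fun x => ∑ a, ‖N a x‖ ^ 2
  have hv : ∀ x, star (v x) ⬝ᵥ v x = (p x : ℂ) := by
    intro x
    simp only [v, p, dotProduct, Pi.star_apply, RCLike.star_def, Complex.conj_mul',
      Complex.ofReal_sum, Complex.ofReal_pow]
  have hp0 : ∀ x, 0 ≤ p x := fun x => Finset.sum_nonneg fun a _ => by positivity
  have hp : ∀ x, p x ≠ 0 := by
    intro x hx
    have hz : v x = 0 := by
      have := hv x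
      rwa [hx, Complex.ofReal_zero, dotProduct_star_self_eq_zero] at this
    have hNx : N *ᵥ Pi.single x 1 = 0 := by
      ext a
      simpa using congr_fun hz a
    have hU0 : U *ᵥ Pi.single x 1 = 0 := by
      rw [show U = h⁻¹ * N by rw [hN, nonsing_inv_mul_cancel_left _ _ hρ.isUnit_cfc_sqrt],
        ← mulVec_mulVec, hNx, mulVec_zero]
    have h4 := congr_arg (· *ᵥ (Pi.single x 1 : Fin d → ℂ)) h1
    simp only [← mulVec_mulVec _ _ U, hU0, mulVec_zero, one_mulVec] at h4
    simpa using congr_fun h4 x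
  have hsq : ∀ x, (√(p x) : ℂ) * √(p x) = p x := fun x => by
    rw [← Complex.ofReal_mul, Real.mul_self_sqrt (hp0 x)]
  have hsq0 : ∀ x, (√(p x) : ℂ) ≠ 0 := fun x hx => hp x (by
    have := hsq x
    rw [hx, mul_zero] at this
    exact_mod_cast this.symm)
  let φ : Fin d → Fin d → ℂ := fun x => (√(p x) : ℂ)⁻¹ • v x
  have hφ : ∀ x, star (φ x) ⬝ᵥ φ x = 1 := by
    intro x
    have hs : star ((√(p x) : ℂ)⁻¹) = (√(p x) : ℂ)⁻¹ := by
      simp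
    simp only [φ]
    rw [star_smul, smul_dotProduct, dotProduct_smul, hv, ← hsq, hs, smul_eq_mul, smul_eq_mul]
    field_simp [hsq0 x]
  have hφv : ∀ x, p x • vecMulVec (φ x) (star (φ x)) = vecMulVec (v x) (star (v x)) := by
    intro x
    ext a b
    have := hsq0 x
    simp only [φ, Matrix.smul_apply, vecMulVec_apply, Pi.star_apply, Pi.smul_apply, smul_eq_mul,
      star_mul', Complex.real_smul, ← hsq x]
    simp only [RCLike.star_def, map_inv₀, Complex.conj_ofReal]
    field_simp
  let Φ := preparationMap (fun x => vecMulVec (φ x) (star (φ x)))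
    fun x => posSemidef_vecMulVec_self_star (φ x)
  have hΦtr : ∀ a, (Φ a).trace = ∑ x, a x := by
    intro a
    rw [preparationMap_apply, trace_sum]
    refine Finset.sum_congr rfl fun x _ => ?_
    rw [trace_smul, trace_vecMulVec, dotProduct_comm, hφ, smul_eq_mul, mul_one]
  have hΦs : ∀ s : Fin d → ℝ, Φ (fun x => ((s x * p x : ℝ) : ℂ)) =
      N * (diagonal fun x => (s x : ℂ)) * Nᴴ := by
    intro s
    rw [mul_diagonal_mul_conjTranspose_eq_sum, preparationMap_apply]
    refine Finset.sum_congr rfl fun x _ => ?_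
    rw [Complex.coe_smul, mul_smul, hφv]
  have hΦp : Φ (fun x => (p x : ℂ)) = ρ := by
    have := hΦs fun _ => 1
    simpa [hNρ] using this
  have hΦq : Φ (fun x => ((t x * p x : ℝ) : ℂ)) = σ := by rw [hΦs, hNσ]
  refine ⟨⟨Φ, p, fun x => t x * p x, hΦtr, ⟨hp0, ?_⟩,
    ⟨fun x => mul_nonneg (ht x) (hp0 x), ?_⟩, hΦp, hΦq⟩, by simp, fun x => ⟨φ x, hφ x, ?_⟩⟩
  · have := hΦtr fun x => (p x : ℂ)
    rw [hΦp, hρ_trace] at this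
    exact_mod_cast this.symm
  · have := hΦtr fun x => ((t x * p x : ℝ) : ℂ)
    rw [hΦq, hσ_trace] at this
    exact_mod_cast this.symm
  · change Φ _ = _
    rw [preparationMap_apply, Finset.sum_eq_single x]
    · simp
    · intro y _ hy
      simp [hy]
    · simp

end

/-! ### Kubo–Ando connections -/

section Uniqueness

variable {f : ℝ → ℝ} {c : ∀ n : ℕ, Matrix (Fin n) (Fin n) ℂ → Matrix (Fin n) (Fin n) ℂ →
  Matrix (Fin n) (Fin n) ℂ}

/-- Embedding the i-th coordinate line bounds 1 c D below by f(t i) times the i-th coordinate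
projection; compressing to that line bounds the i-th diagonal entry above by f(t i). -/
lemma IsConnectionOf.apply_one_diagonal (hc : IsConnectionOf f c) {n : ℕ} {t : Fin n → ℝ}
    (ht : ∀ i, 0 ≤ t i) :
    c n 1 (diagonal fun i => (t i : ℂ)) = diagonal fun i => (f (t i) : ℂ) := by
  obtain ⟨hc, hcf⟩ := hc
  set D : Matrix (Fin n) (Fin n) ℂ := diagonal fun i => (t i : ℂ) with hD
  have hDpos : D.PosSemidef := .diagonal fun i => by simpa using ht i
  have hlow : ∀ i, (diagonal fun j => if j = i then (f (t i) : ℂ) else 0) ≤ c n 1 D := by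
    intro i
    let S : Matrix (Fin n) (Fin 1) ℂ := of fun a _ => (Pi.single i 1 : Fin n → ℂ) a
    have hS : ∀ s : ℝ, S * ((s : ℂ) • (1 : Matrix (Fin 1) (Fin 1) ℂ)) * Sᴴ =
        diagonal fun j => if j = i then (s : ℂ) else 0 := by
      intro s
      ext a b
      simp only [S, mul_apply, Fin.sum_univ_one, of_apply, conjTranspose_apply, Matrix.smul_apply,
        one_apply_eq, smul_eq_mul, mul_one, diagonal_apply, Pi.single_apply]
      by_cases h1 : a = i <;> by_cases h2 : b = i <;> by_cases h3 : a = b <;> simp_all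
    have h1 := hc.transformer n 1 S 1 ((t i : ℂ) • 1) .one
      (PosSemidef.one.smul (by simpa using ht i))
    have hS1 := hS 1
    simp only [Complex.ofReal_one, one_smul] at hS1
    rw [hcf 1 (t i) (ht i), hS, hS, hS1] at h1
    refine h1.trans (hc.monotone n _ _ _ _ ?_ ?_ ?_ ?_)
    · exact .diagonal fun j => by dsimp; split_ifs <;> simp
    · exact .diagonal fun j => by dsimp; split_ifs <;> simp [ht]
    · rw [le_iff, ← diagonal_one, diagonal_sub]
      exact .diagonal fun j => by dsimp; split_ifs <;> simp
    · rw [le_iff, hD, diagonal_sub]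
      refine .diagonal fun j => ?_
      dsimp
      split_ifs with h
      · simp [h]
      · simpa using ht j
  have hup : ∀ i, c n 1 D i i ≤ f (t i) := by
    intro i
    let S : Matrix (Fin 1) (Fin n) ℂ := of fun _ a => (Pi.single i 1 : Fin n → ℂ) a
    have hS : ∀ Y : Matrix (Fin n) (Fin n) ℂ, S * Y * Sᴴ = (Y i i) • 1 := by
      intro Y
      ext a b
      fin_cases a; fin_cases b
      simp [S, mul_apply, Pi.single_apply]
    have h1 := hc.transformer 1 n S 1 D .one hDpos
    rw [hS, hS, hS] at h1
    simp only [one_apply_eq, one_smul, hD, diagonal_apply_eq] at h1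
    rw [← hD, hcf 1 (t i) (ht i), le_iff, ← sub_smul] at h1
    have := h1.diag_nonneg (i := 0)
    simpa using this
  have hii : ∀ i, c n 1 D i i = f (t i) := by
    intro i
    refine le_antisymm (hup i) ?_
    have := (le_iff.1 (hlow i)).diag_nonneg (i := i)
    simpa using this
  ext i j
  by_cases hij : i = j
  · subst hij
    rw [hii, diagonal_apply_eq]
  rw [diagonal_apply_ne _ hij]
  -- A positive semidefinite matrix with a zero diagonal entry has the whole column zero, which
  -- kills the off-diagonal entries.
  have hpos := le_iff.1 (hlow j)
  have h0 := (hpos.dotProduct_mulVec_zero_iff (Pi.single j 1)).1 (by simp [hii])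
  simpa [hij] using congr_fun h0 i

/-- For invertible `S` the transformer inequality is an equality. -/
lemma IsOperatorConnection.transformer_eq (hc : IsOperatorConnection c) {n : ℕ}
    {S T A B : Matrix (Fin n) (Fin n) ℂ} (hST : S * T = 1) (hA : A.PosSemidef)
    (hB : B.PosSemidef) : c n (S * A * Sᴴ) (S * B * Sᴴ) = S * c n A B * Sᴴ := by
  have hTS : T * S = 1 := mul_eq_one_comm.1 hST
  have hcancel : ∀ Y : Matrix (Fin n) (Fin n) ℂ, T * (S * Y * Sᴴ) * Tᴴ = Y := by
    intro Y
    rw [show T * (S * Y * Sᴴ) * Tᴴ = (T * S) * Y * (T * S)ᴴ by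
      rw [conjTranspose_mul]; simp only [Matrix.mul_assoc], hTS]
    simp
  have hcancel' : ∀ Y : Matrix (Fin n) (Fin n) ℂ, S * (T * Y * Tᴴ) * Sᴴ = Y := by
    intro Y
    rw [show S * (T * Y * Tᴴ) * Sᴴ = (S * T) * Y * (S * T)ᴴ by
      rw [conjTranspose_mul]; simp only [Matrix.mul_assoc], hST]
    simp
  refine le_antisymm ?_ (hc.transformer n n S A B hA hB)
  have h := hc.transformer n n T _ _ (hA.mul_mul_conjTranspose_same S)
    (hB.mul_mul_conjTranspose_same S)
  rw [hcancel, hcancel] at h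
  have h2 := mul_mul_conjTranspose_mono h S
  rwa [hcancel'] at h2

/-- A connection is determined by its representing function. -/
lemma IsConnectionOf.eq_matrixPerspective (hc : IsConnectionOf f c) {n : ℕ}
    {ρ σ : Matrix (Fin n) (Fin n) ℂ} (hρ : ρ.PosDef) (hσ : σ.PosSemidef) :
    c n ρ σ = matrixPerspective f ρ σ := by
  set h := cfc Real.sqrt ρ with hh
  have hhh : hᴴ = h := conjTranspose_cfc_sqrt
  have hM := hσ.inv_sqrt_conj ρ
  rw [← hh] at hM
  obtain ⟨U, t, h1, h2, hU⟩ := hM.1.exists_eq_unitary_mul_diagonal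
  have ht : ∀ i, 0 ≤ t i := PosSemidef.diagonal_nonneg_of_unitary h1 (hU ▸ hM)
  have e1 : c n 1 (h⁻¹ * σ * h⁻¹) = cfc f (h⁻¹ * σ * h⁻¹) := by
    have := hc.1.transformer_eq (S := U) (T := Uᴴ) h2 .one
      (.diagonal fun i => by simpa using ht i : (diagonal fun i => (t i : ℂ)).PosSemidef)
    rw [Matrix.mul_one, h2, hc.apply_one_diagonal ht] at this
    rw [hU, this, cfc_unitary_mul_diagonal h1 h2]
  have := hc.1.transformer_eq (S := h) (T := h⁻¹) (mul_nonsing_inv _ hρ.isUnit_cfc_sqrt) .one hM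
  rw [hhh, Matrix.mul_one, hρ.sqrt_mul_inv_sqrt_conj_mul, hρ.posSemidef.cfc_sqrt_mul_self, e1]
    at this
  exact this

end Uniqueness

/-! ### Existence of the connection -/

/-- **Hansen's inequality** for contractions. -/
lemma OperatorMonotone.contraction_le {f : ℝ → ℝ} (hf : OperatorMonotone f) (hf0 : 0 ≤ f 0)
    {m n : ℕ} {K : Matrix (Fin m) (Fin n) ℂ} (hK : K * Kᴴ ≤ 1) {M : Matrix (Fin n) (Fin n) ℂ}
    (hM : M.PosSemidef) : K * cfc f M * Kᴴ ≤ cfc f (K * M * Kᴴ) := by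
  obtain ⟨U, t, h1, h2, hU⟩ := hM.1.exists_eq_unitary_mul_diagonal
  have ht : ∀ i, 0 ≤ t i := PosSemidef.diagonal_nonneg_of_unitary h1 (hU ▸ hM)
  set N := K * U with hN
  have key : ∀ s : Fin n → ℝ, K * (U * (diagonal fun i => (s i : ℂ)) * Uᴴ) * Kᴴ =
      ∑ x, s x • vecMulVec (fun a => N a x) (star fun a => N a x) := by
    intro s
    rw [← mul_diagonal_mul_conjTranspose_eq_sum, hN, conjTranspose_mul]
    simp only [Matrix.mul_assoc]
  have hKK : K * Kᴴ = ∑ x, vecMulVec (fun a => N a x) (star fun a => N a x) := by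
    have := key fun _ => 1
    simpa [h2] using this
  -- The defect 1 - K Kᴴ completes the weights to a resolution of the identity; placed at the point
  -- 0 it contributes f(0)(1 - K Kᴴ) ≥ 0, which can be dropped.
  let G : Option (Fin n) → Matrix (Fin m) (Fin m) ℂ := fun o => o.elim (1 - K * Kᴴ)
    fun x => vecMulVec (fun a => N a x) (star fun a => N a x)
  let s : Option (Fin n) → ℝ := fun o => o.elim 0 t
  have hG : ∀ o, (G o).PosSemidef := by
    rintro (_ | x)
    · exact le_iff.1 hK
    · exact posSemidef_vecMulVec_self_star _
  have hJ := hf.sum_smul_le_cfc hG (by simp [G, Fintype.sum_option, hKK]) (t := s)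
    (by rintro (_ | x); exacts [le_rfl, ht x])
  simp only [G, s, Fintype.sum_option, Option.elim, zero_smul, zero_add] at hJ
  rw [← key t, ← key fun x => f (t x), ← hU, ← cfc_unitary_mul_diagonal h1 h2, ← hU] at hJ
  exact (le_add_of_nonneg_left ((le_iff.1 hK).smul hf0).nonneg).trans hJ

/-! ### Monotonicity and the transformer inequality for positive definite first arguments. -/

section Existence

variable {f : ℝ → ℝ}

lemma matrixPerspective_posSemidef (hpos : ∀ t, 0 ≤ t → 0 ≤ f t) {n : ℕ}
    (A : Matrix (Fin n) (Fin n) ℂ) {B : Matrix (Fin n) (Fin n) ℂ} (hB : B.PosSemidef) :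
    (matrixPerspective f A B).PosSemidef := by
  have hM := hB.inv_sqrt_conj A
  have : (cfc f ((cfc Real.sqrt A)⁻¹ * B * (cfc Real.sqrt A)⁻¹)).PosSemidef :=
    nonneg_iff_posSemidef.1 (cfc_nonneg fun x hx => hpos x (spectrum_nonneg_of_nonneg hM.nonneg hx))
  simpa [conjTranspose_cfc_sqrt, matrixPerspective] using
    this.mul_mul_conjTranspose_same (cfc Real.sqrt A)

/-- The hypothesis S A Sᴴ ≤ C says exactly that K = C^{-1/2} S A^{1/2} is a contraction, so Hansen's
inequality applies. Allowing a larger C avoids inverting a singular S A Sᴴ, and S = 1 gives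
monotonicity in the first argument. -/
lemma matrixPerspective_transformer (hf : OperatorMonotone f) (hf0 : 0 ≤ f 0) {m n : ℕ}
    {S : Matrix (Fin m) (Fin n) ℂ} {A B : Matrix (Fin n) (Fin n) ℂ} {C : Matrix (Fin m) (Fin m) ℂ}
    (hA : A.PosDef) (hB : B.PosSemidef) (hC : C.PosDef) (hS : S * A * Sᴴ ≤ C) :
    S * matrixPerspective f A B * Sᴴ ≤ matrixPerspective f C (S * B * Sᴴ) := by
  set a := cfc Real.sqrt A with ha
  set c := cfc Real.sqrt C with hc
  have hah : aᴴ = a := conjTranspose_cfc_sqrt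
  have hch : cᴴ = c := conjTranspose_cfc_sqrt
  have hcih : (c⁻¹)ᴴ = c⁻¹ := conjTranspose_inv_cfc_sqrt
  have haa : a * a = A := hA.posSemidef.cfc_sqrt_mul_self
  set K := c⁻¹ * S * a with hK
  have hKh : Kᴴ = a * Sᴴ * c⁻¹ := by
    rw [hK, conjTranspose_mul, conjTranspose_mul, hah, hcih, Matrix.mul_assoc]
  have hKK : K * Kᴴ ≤ 1 := by
    have h1 := mul_mul_conjTranspose_mono hS c⁻¹
    rw [hcih, hC.inv_sqrt_mul_mul_inv_sqrt] at h1
    convert h1 using 1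
    rw [hKh, hK, ← haa]
    simp only [Matrix.mul_assoc]
  have hM : (a⁻¹ * B * a⁻¹).PosSemidef := hB.inv_sqrt_conj A
  have hKM : K * (a⁻¹ * B * a⁻¹) * Kᴴ = c⁻¹ * (S * B * Sᴴ) * c⁻¹ := by
    conv_rhs => rw [← hA.sqrt_mul_inv_sqrt_conj_mul B]
    rw [hKh, hK]
    simp only [Matrix.mul_assoc, ha]
  have hcK : c * K = S * a := by
    rw [hK, Matrix.mul_assoc, mul_nonsing_inv_cancel_left _ _ hC.isUnit_cfc_sqrt]
  have hKc : Kᴴ * c = a * Sᴴ := by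
    rw [hKh, nonsing_inv_mul_cancel_right _ _ hC.isUnit_cfc_sqrt]
  have hJ := mul_mul_conjTranspose_mono (hf.contraction_le hf0 hKK hM) c
  rw [hch, hKM] at hJ
  refine le_trans (le_of_eq ?_) hJ
  rw [matrixPerspective, ← ha]
  calc S * (a * cfc f (a⁻¹ * B * a⁻¹) * a) * Sᴴ
      = (S * a) * cfc f (a⁻¹ * B * a⁻¹) * (a * Sᴴ) := by simp only [Matrix.mul_assoc]
    _ = _ := by rw [← hcK, ← hKc]; simp only [Matrix.mul_assoc]

lemma matrixPerspective_mono (hf : OperatorMonotone f) (hf0 : 0 ≤ f 0) {n : ℕ}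
    {A B C D : Matrix (Fin n) (Fin n) ℂ} (hA : A.PosDef) (hB : B.PosSemidef) (hC : C.PosDef)
    (hAC : A ≤ C) (hBD : B ≤ D) : matrixPerspective f A B ≤ matrixPerspective f C D := by
  have hD : D.PosSemidef := nonneg_iff_posSemidef.1 (hB.nonneg.trans hBD)
  have h1 := matrixPerspective_transformer hf hf0 (S := 1) hA hB hC (by simpa using hAC)
  simp only [Matrix.one_mul, conjTranspose_one, Matrix.mul_one] at h1
  refine h1.trans ?_
  have h2 := mul_mul_conjTranspose_mono hBD (cfc Real.sqrt C)⁻¹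
  rw [conjTranspose_inv_cfc_sqrt] at h2
  have h3 := mul_mul_conjTranspose_mono (hf n _ _ (hB.inv_sqrt_conj C) (hD.inv_sqrt_conj C) h2)
    (cfc Real.sqrt C)
  rwa [conjTranspose_cfc_sqrt] at h3

end Existence

/-! ### Limits of perspectives and the connection for singular first arguments. -/

section Limits

open scoped Matrix.Norms.L2Operator

lemma Matrix.tendsto_cfc_of_posSemidef {f : ℝ → ℝ} (hfc : ContinuousOn f (Set.Ici 0)) {n : Type*}
    [Fintype n] [DecidableEq n] {α : Type*} {l : Filter α} {A : α → Matrix n n ℂ}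
    {A₀ : Matrix n n ℂ} (hA : ∀ᶠ x in l, (A x).PosSemidef) (hA₀ : A₀.PosSemidef)
    (h : Tendsto A l (𝓝 A₀)) : Tendsto (fun x => cfc f (A x)) l (𝓝 (cfc f A₀)) := by
  -- Eventually bounded norms put all the spectra in one compact interval of [0, ∞).
  have hsub : ∀ B : Matrix n n ℂ, B.PosSemidef → ‖B‖ ≤ ‖A₀‖ + 1 →
      spectrum ℝ B ⊆ Set.Icc 0 ((‖A₀‖ + 1) * ‖(1 : Matrix n n ℂ)‖) := by
    intro B hB hle x hx
    refine ⟨spectrum_nonneg_of_nonneg hB.nonneg hx, (le_abs_self x).trans ?_⟩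
    exact (spectrum.norm_le_norm_mul_of_mem hx).trans (by gcongr)
  have hnorm : ∀ᶠ x in l, ‖A x‖ ≤ ‖A₀‖ + 1 :=
    (h.norm.eventually (eventually_lt_nhds (lt_add_one _))).mono fun _ => le_of_lt
  refine h.cfc isCompact_Icc f ?_ (hA.mono fun x hx => hx.1.isSelfAdjoint)
    (hsub A₀ hA₀ (by linarith)) hA₀.1.isSelfAdjoint (hfc.mono Set.Icc_subset_Ici_self)
  filter_upwards [hA, hnorm] with x h1 h2 using hsub _ h1 h2

lemma tendsto_matrixPerspective {f : ℝ → ℝ} (hfc : ContinuousOn f (Set.Ici 0)) {n : ℕ}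
    {α : Type*} {l : Filter α} {A B : α → Matrix (Fin n) (Fin n) ℂ}
    {A₀ B₀ : Matrix (Fin n) (Fin n) ℂ} (hA : ∀ᶠ x in l, (A x).PosSemidef)
    (hB : ∀ᶠ x in l, (B x).PosSemidef) (hA₀ : A₀.PosDef) (hB₀ : B₀.PosSemidef)
    (hAt : Tendsto A l (𝓝 A₀)) (hBt : Tendsto B l (𝓝 B₀)) :
    Tendsto (fun x => matrixPerspective f (A x) (B x)) l (𝓝 (matrixPerspective f A₀ B₀)) := by
  have h1 := tendsto_cfc_of_posSemidef Real.continuous_sqrt.continuousOn hA hA₀.posSemidef hAt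
  have h2 : Tendsto (fun x => (cfc Real.sqrt (A x))⁻¹) l (𝓝 (cfc Real.sqrt A₀)⁻¹) := by
    refine (continuousAt_matrix_inv _ ?_).tendsto.comp h1
    obtain ⟨u, hu⟩ := hA₀.isUnit_cfc_sqrt
    rw [← hu]
    exact NormedRing.inverse_continuousAt u
  have h3 := tendsto_cfc_of_posSemidef hfc (hB.mono fun x hx => hx.inv_sqrt_conj (A x))
    (hB₀.inv_sqrt_conj A₀) ((h2.mul hBt).mul h2)
  exact (h1.mul h3).mul h1

/-- This turns convergence of the traces of a monotone family into convergence in norm. -/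
lemma Matrix.PosSemidef.norm_le_trace {n : Type*} [Fintype n] [DecidableEq n] {A : Matrix n n ℂ}
    (hA : A.PosSemidef) : ‖A‖ ≤ A.trace.re := by
  obtain ⟨U, t, h1, h2, hU⟩ := hA.1.exists_eq_unitary_mul_diagonal
  have ht : ∀ i, 0 ≤ t i := PosSemidef.diagonal_nonneg_of_unitary h1 (hU ▸ hA)
  have htr : A.trace.re = ∑ i, t i := by
    rw [hU, trace_mul_comm, ← Matrix.mul_assoc, h1, Matrix.one_mul, trace_diagonal,
      ← Complex.ofReal_sum, Complex.ofReal_re]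
  have hle : A ≤ (∑ i, t i) • 1 := by
    have h3 : (diagonal fun i => (t i : ℂ)) ≤ (∑ i, t i) • (1 : Matrix n n ℂ) := by
      rw [le_iff, ← diagonal_one, ← diagonal_smul, diagonal_sub]
      refine .diagonal fun i => ?_
      have : t i ≤ ∑ i, t i := Finset.single_le_sum (fun j _ => ht j) (Finset.mem_univ i)
      have h4 : (t i : ℂ) ≤ ((∑ i, t i : ℝ) : ℂ) := by exact_mod_cast this
      simpa using h4
    have h5 := mul_mul_conjTranspose_mono h3 U
    rwa [← hU, Matrix.mul_smul, Matrix.mul_one, Matrix.smul_mul, h2] at h5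
  rw [htr]
  cases isEmpty_or_nonempty n
  · simp [Subsingleton.elim A 0]
  · have h6 := CStarAlgebra.norm_le_norm_of_nonneg_of_le hA.nonneg hle
    refine h6.trans ?_
    rw [norm_smul, norm_one, mul_one, Real.norm_of_nonneg (Finset.sum_nonneg fun i _ => ht i)]

lemma Matrix.trace_re_mono {n : Type*} [Fintype n] {A B : Matrix n n ℂ} (h : A ≤ B) :
    A.trace.re ≤ B.trace.re := by
  have h1 := (le_iff.1 h).trace_nonneg
  rw [trace_sub] at h1
  have h2 : 0 ≤ B.trace.re - A.trace.re := (Complex.le_def.1 h1).1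
  exact sub_nonneg.1 h2

/-- A monotone family of positive semidefinite matrices on `(0, ∞)` converges at `0`. -/
lemma Matrix.exists_tendsto_nhdsGT_zero {n : Type*} [Fintype n] [DecidableEq n]
    {P : ℝ → Matrix n n ℂ} (hP : ∀ ε, 0 < ε → (P ε).PosSemidef)
    (hmono : ∀ ε δ, 0 < ε → ε ≤ δ → P ε ≤ P δ) : ∃ L, Tendsto P (𝓝[>] 0) (𝓝 L) := by
  have hmon : MonotoneOn (fun ε => (P ε).trace.re) (Set.Ioi 0) := fun ε hε δ _ h =>
    trace_re_mono (hmono ε δ hε h)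
  have hbdd : BddBelow ((fun ε => (P ε).trace.re) '' Set.Ioi 0) := by
    refine ⟨0, ?_⟩
    rintro _ ⟨ε, hε, rfl⟩
    exact (Complex.le_def.1 (hP ε hε).trace_nonneg).1
  have hlim := hmon.tendsto_nhdsGT hbdd
  refine cauchy_map_iff_exists_tendsto.1 ?_
  have hc := hlim.cauchy_map
  rw [Metric.cauchy_iff] at hc ⊢
  refine ⟨inferInstance, fun η hη => ?_⟩
  obtain ⟨s, hs, h⟩ := hc.2 η hη
  refine ⟨P '' ((fun ε => (P ε).trace.re) ⁻¹' s ∩ Set.Ioi 0),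
    image_mem_map (inter_mem hs self_mem_nhdsWithin), ?_⟩
  have key : ∀ ε δ, 0 < ε → ε ≤ δ → dist (P ε) (P δ) ≤ dist (P ε).trace.re (P δ).trace.re := by
    intro ε δ hε hεδ
    have h1 := (le_iff.1 (hmono ε δ hε hεδ)).norm_le_trace
    rw [trace_sub, Complex.sub_re] at h1
    rw [dist_comm, dist_eq_norm, dist_comm, Real.dist_eq]
    exact h1.trans (le_abs_self _)
  rintro _ ⟨ε, ⟨hε, hε0⟩, rfl⟩ _ ⟨δ, ⟨hδ, hδ0⟩, rfl⟩
  rcases le_total ε δ with hle | hle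
  · exact (key ε δ hε0 hle).trans_lt (h _ hε _ hδ)
  · rw [dist_comm]
    exact (key δ ε hδ0 hle).trans_lt (h _ hδ _ hε)

/-- The Kubo–Ando connection with representing function `f`. -/
noncomputable def kuboAndo (f : ℝ → ℝ) (n : ℕ) (A B : Matrix (Fin n) (Fin n) ℂ) :
    Matrix (Fin n) (Fin n) ℂ :=
  limUnder (𝓝[>] (0 : ℝ)) fun ε => matrixPerspective f (A + ε • 1) B

variable {f : ℝ → ℝ}

lemma Matrix.PosSemidef.add_smul_one_posDef {n : Type*} [Fintype n] [DecidableEq n]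
    {A : Matrix n n ℂ} (hA : A.PosSemidef) {ε : ℝ} (hε : 0 < ε) : (A + ε • 1).PosDef :=
  PosDef.posSemidef_add hA (PosDef.one.smul hε)

lemma Matrix.smul_one_mono {n : Type*} [Fintype n] [DecidableEq n] {ε δ : ℝ} (h : ε ≤ δ) :
    ε • (1 : Matrix n n ℂ) ≤ δ • (1 : Matrix n n ℂ) := by
  rw [le_iff, ← sub_smul]
  exact PosSemidef.one.smul (sub_nonneg.2 h)

/-- The perspectives decrease as ε ↓ 0 and stay positive semidefinite, so the limit in the
definition exists. -/
lemma tendsto_kuboAndo (hf : OperatorMonotone f) (hpos : ∀ t, 0 ≤ t → 0 ≤ f t) {n : ℕ}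
    {A B : Matrix (Fin n) (Fin n) ℂ} (hA : A.PosSemidef) (hB : B.PosSemidef) :
    Tendsto (fun ε : ℝ => matrixPerspective f (A + ε • 1) B) (𝓝[>] 0) (𝓝 (kuboAndo f n A B)) := by
  refine tendsto_nhds_limUnder (exists_tendsto_nhdsGT_zero
    (fun ε _ => matrixPerspective_posSemidef hpos _ hB) fun ε δ hε h => ?_)
  exact matrixPerspective_mono hf (hpos 0 le_rfl) (hA.add_smul_one_posDef hε) hB
    (hA.add_smul_one_posDef (hε.trans_le h)) (add_le_add_right (smul_one_mono h) A) le_rfl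

lemma kuboAndo_eq_matrixPerspective (hfc : ContinuousOn f (Set.Ici 0)) {n : ℕ}
    {A B : Matrix (Fin n) (Fin n) ℂ} (hA : A.PosDef) (hB : B.PosSemidef) :
    kuboAndo f n A B = matrixPerspective f A B := by
  refine Tendsto.limUnder_eq (tendsto_matrixPerspective hfc ?_ (.of_forall fun _ => hB) hA hB ?_
    tendsto_const_nhds)
  · filter_upwards [self_mem_nhdsWithin] with ε hε
    exact (hA.posSemidef.add_smul_one_posDef hε).posSemidef
  · exact tendsto_nhdsWithin_of_tendsto_nhds (Continuous.tendsto' (by fun_prop) _ _ (by simp))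

lemma kuboAndo_mono (hf : OperatorMonotone f) (hpos : ∀ t, 0 ≤ t → 0 ≤ f t) {n : ℕ}
    {A B C D : Matrix (Fin n) (Fin n) ℂ} (hA : A.PosSemidef) (hB : B.PosSemidef) (hAC : A ≤ C)
    (hBD : B ≤ D) : kuboAndo f n A B ≤ kuboAndo f n C D := by
  have hC : C.PosSemidef := nonneg_iff_posSemidef.1 (hA.nonneg.trans hAC)
  have hD : D.PosSemidef := nonneg_iff_posSemidef.1 (hB.nonneg.trans hBD)
  refine le_of_tendsto_of_tendsto (tendsto_kuboAndo hf hpos hA hB) (tendsto_kuboAndo hf hpos hC hD)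
    ?_
  filter_upwards [self_mem_nhdsWithin] with ε hε
  exact matrixPerspective_mono hf (hpos 0 le_rfl) (hA.add_smul_one_posDef hε) hB
    (hC.add_smul_one_posDef hε) (add_le_add_left hAC _) hBD

lemma kuboAndo_le_matrixPerspective (hf : OperatorMonotone f) (hpos : ∀ t, 0 ≤ t → 0 ≤ f t)
    {n : ℕ} {A B : Matrix (Fin n) (Fin n) ℂ} (hA : A.PosSemidef) (hB : B.PosSemidef) {ε : ℝ}
    (hε : 0 < ε) : kuboAndo f n A B ≤ matrixPerspective f (A + ε • 1) B := by
  refine le_of_tendsto (tendsto_kuboAndo hf hpos hA hB) ?_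
  filter_upwards [self_mem_nhdsWithin,
    nhdsWithin_le_nhds (eventually_le_nhds hε)] with δ hδ hle
  exact matrixPerspective_mono hf (hpos 0 le_rfl) (hA.add_smul_one_posDef hδ) hB
    (hA.add_smul_one_posDef hε) (add_le_add_right (smul_one_mono hle) A) le_rfl

lemma kuboAndo_transformer (hf : OperatorMonotone f) (hpos : ∀ t, 0 ≤ t → 0 ≤ f t) {m n : ℕ}
    (S : Matrix (Fin m) (Fin n) ℂ) {A B : Matrix (Fin n) (Fin n) ℂ} (hA : A.PosSemidef)
    (hB : B.PosSemidef) :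
    S * kuboAndo f n A B * Sᴴ ≤ kuboAndo f m (S * A * Sᴴ) (S * B * Sᴴ) := by
  -- S(A + ε)Sᴴ ≤ S A Sᴴ + εw, so the perturbation on the right is run at the scale εw; the summand
  -- 1 keeps w positive when S = 0.
  set w := ‖S * Sᴴ‖ + 1 with hw
  have hw0 : 0 < w := by positivity
  have hSS : S * Sᴴ ≤ w • 1 := by
    have := (posSemidef_self_mul_conjTranspose S).1.isSelfAdjoint.le_algebraMap_norm_self
    rw [Algebra.algebraMap_eq_smul_one] at this
    exact this.trans (smul_one_mono (by linarith))
  have hSA := hA.mul_mul_conjTranspose_same S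
  have hscale : Tendsto (fun ε : ℝ => ε * w) (𝓝[>] 0) (𝓝[>] 0) := by
    refine tendsto_nhdsWithin_iff.2 ⟨tendsto_nhdsWithin_of_tendsto_nhds
      (Continuous.tendsto' (by fun_prop) _ _ (by simp)), ?_⟩
    filter_upwards [self_mem_nhdsWithin] with ε hε using mul_pos hε hw0
  have hconj : Continuous fun Y : Matrix (Fin n) (Fin n) ℂ => S * Y * Sᴴ :=
    (continuous_const.matrix_mul continuous_id).matrix_mul continuous_const
  refine le_of_tendsto_of_tendsto ((hconj.tendsto _).comp (tendsto_kuboAndo hf hpos hA hB))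
    ((tendsto_kuboAndo hf hpos hSA (hB.mul_mul_conjTranspose_same S)).comp hscale) ?_
  filter_upwards [self_mem_nhdsWithin] with ε hε
  refine matrixPerspective_transformer hf (hpos 0 le_rfl) (hA.add_smul_one_posDef hε) hB
    (hSA.add_smul_one_posDef (mul_pos hε hw0)) ?_
  have h1 := (le_iff.1 hSS).smul (le_of_lt hε : (0 : ℝ) ≤ ε)
  rw [le_iff]
  convert h1 using 1
  simp only [Matrix.mul_add, Matrix.add_mul, Matrix.mul_smul, Matrix.smul_mul, Matrix.mul_one]
  module

/-- The values lie between the limit value and the perspectives at A j + ε. For one fixed ε these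
converge in j to the perspective at A₀ + ε, which is within η of the limit value. -/
lemma kuboAndo_continuous_above (hf : OperatorMonotone f) (hfc : ContinuousOn f (Set.Ici 0))
    (hpos : ∀ t, 0 ≤ t → 0 ≤ f t) {n : ℕ} {A B : ℕ → Matrix (Fin n) (Fin n) ℂ}
    {A₀ B₀ : Matrix (Fin n) (Fin n) ℂ} (hA : ∀ j, (A j).PosSemidef) (hB : ∀ j, (B j).PosSemidef)
    (hAanti : Antitone A) (hBanti : Antitone B) (hAt : Tendsto A atTop (𝓝 A₀))
    (hBt : Tendsto B atTop (𝓝 B₀)) :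
    Tendsto (fun j => kuboAndo f n (A j) (B j)) atTop (𝓝 (kuboAndo f n A₀ B₀)) := by
  have hA₀ : A₀.PosSemidef :=
    nonneg_iff_posSemidef.1 (ge_of_tendsto' hAt fun j => (hA j).nonneg)
  have hB₀ : B₀.PosSemidef :=
    nonneg_iff_posSemidef.1 (ge_of_tendsto' hBt fun j => (hB j).nonneg)
  have hlow : ∀ j, kuboAndo f n A₀ B₀ ≤ kuboAndo f n (A j) (B j) := fun j =>
    kuboAndo_mono hf hpos hA₀ hB₀ (hAanti.le_of_tendsto hAt j) (hBanti.le_of_tendsto hBt j)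
  rw [Metric.tendsto_nhds]
  intro η hη
  obtain ⟨ε, hεη, hε⟩ := ((Metric.tendsto_nhds.1 (tendsto_kuboAndo hf hpos hA₀ hB₀) η hη).and
    self_mem_nhdsWithin).exists
  have hε : 0 < ε := hε
  have hlim := tendsto_matrixPerspective hfc (l := atTop) (A := fun j => A j + ε • 1) (B := B)
    (.of_forall fun j => ((hA j).add_smul_one_posDef hε).posSemidef) (.of_forall hB)
    (hA₀.add_smul_one_posDef hε) hB₀ (hAt.add_const _) hBt
  have hlt := (hlim.dist (tendsto_const_nhds (x := kuboAndo f n A₀ B₀))).eventually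
    (eventually_lt_nhds hεη)
  filter_upwards [hlt] with j hj
  refine lt_of_le_of_lt ?_ hj
  rw [dist_eq_norm, dist_eq_norm]
  exact CStarAlgebra.norm_le_norm_of_nonneg_of_le (sub_nonneg.2 (hlow j))
    (sub_le_sub_right (kuboAndo_le_matrixPerspective hf hpos (hA j) (hB j) hε) _)

/-- A continuous nonnegative operator monotone function has a Kubo–Ando connection. -/
lemma isConnectionOf_kuboAndo (hf : OperatorMonotone f) (hfc : ContinuousOn f (Set.Ici 0))
    (hpos : ∀ t, 0 ≤ t → 0 ≤ f t) : IsConnectionOf f (kuboAndo f) where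
  left :=
    { posSemidef := fun n A B hA hB => nonneg_iff_posSemidef.1
        (ge_of_tendsto (tendsto_kuboAndo hf hpos hA hB) (.of_forall fun _ =>
          (matrixPerspective_posSemidef hpos _ hB).nonneg))
      monotone := fun n A B C D hA hB => kuboAndo_mono hf hpos hA hB
      transformer := fun m n S A B hA hB => kuboAndo_transformer hf hpos S hA hB
      continuous_above := fun n A B A₀ B₀ => kuboAndo_continuous_above hf hfc hpos }
  right n t ht := by
    have hs : cfc Real.sqrt (1 : Matrix (Fin n) (Fin n) ℂ) = 1 := by
      simp
    rw [kuboAndo_eq_matrixPerspective hfc .one (PosSemidef.one.smul (by simpa using ht)),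
      matrixPerspective, hs, inv_one, Matrix.one_mul, Matrix.one_mul, Matrix.mul_one,
      Matrix.mul_one, Complex.coe_smul, cfc_real_smul_one, Complex.coe_smul]

end Limits

theorem mainTheorem3 (f : ℝ → ℝ) (hf : OperatorMonotone f) (d : ℕ)
    (ρ σ : Matrix (Fin d) (Fin d) ℂ)
    (hρ : ρ.PosDef) (hρ_trace : ρ.trace = 1) (hσ : σ.PosSemidef) (hσ_trace : σ.trace = 1) :
    -- the maximum over all reverse tests exists and equals `F'_f(ρ, σ)`
    IsGreatest (reverseTestValues f ρ σ) (FPrime f ρ σ) ∧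
    -- minimal reverse tests exist, and every one of them attains the maximum
    (∃ (X : Type) (_ : Fintype X) (R : ReverseTest X ρ σ), R.IsMinimal) ∧
    (∀ (X : Type) [Fintype X] (R : ReverseTest X ρ σ), R.IsMinimal →
      classicalF f R.p R.q = FPrime f ρ σ) ∧
    -- for continuous `f ≥ 0`, the value is `tr (ρ ♮ σ)` for the Kubo–Ando connection `♮` of `f`
    (ContinuousOn f (Set.Ici 0) → (∀ t : ℝ, 0 ≤ t → 0 ≤ f t) →
      (∃ c, IsConnectionOf f c) ∧
      ∀ c, IsConnectionOf f c →
        c d ρ σ = matrixPerspective f ρ σ ∧ (FPrime f ρ σ : ℂ) = (c d ρ σ).trace) := by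
  obtain ⟨R, hR⟩ := exists_isMinimal hρ hρ_trace hσ hσ_trace
  refine ⟨⟨⟨Fin d, inferInstance, R, (hR.classicalF_eq f hρ).symm⟩, ?_⟩,
    ⟨Fin d, inferInstance, R, hR⟩, fun X _ R hR => hR.classicalF_eq f hρ, fun hfc hpos =>
    ⟨⟨kuboAndo f, isConnectionOf_kuboAndo hf hfc hpos⟩, fun c hc => ?_⟩⟩
  · rintro _ ⟨X, _, R, rfl⟩
    exact R.classicalF_le hf hρ
  · have h := hc.eq_matrixPerspective hρ hσ
    refine ⟨h, ?_⟩
    rw [h, FPrime]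
    -- `FPrime` is only the real part of a trace; positivity shows that the imaginary part vanishes.
    have h0 := (matrixPerspective_posSemidef hpos ρ hσ).trace_nonneg
    exact Complex.ext rfl (by simpa using (Complex.le_def.1 h0).2)
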